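/- Let $p$ be an odd prime, $n\ge 1$, $G=\mathbb Z_{p^n}\oplus\mathbb Z_{p^n}$, and let $\Delta$ be the set of all cyclic subgroups of $G$. For $H\in\Delta$ put $\mathrm{Sons}(H)=\{F\in\Delta : pF=H\}$ and $l(H)=i$ if $|H|=p^i$, and let $O_H$ be the set of generators of $H$. For integers $a_1,\dots,a_n$ with $0\le a_1\le p+1$ and $0\le a_m\le p-1$ $(2\le m\le n)$, a set $T\subseteq\Delta$ is called $(a_1,\dots,a_n)$-homogeneous if $\{0\}\notin T$ and, for every $H\in\Delta$ with $0\le l(H)<n$, the number $|\mathrm{Sons}(H)\cap T|$ equals $a_{l(H)+1}+1$ if $H\in T$ and $a_{l(H)+1}$ if $H\notin T$. For a finite abelian group $A$ and $S\subseteq A$ with $0\notin S=-S$, let $\Gamma_A(S)$ be the Cayley graph in which $x,y$ are adjacent iff $y-x\in S$. We say that it is a strongly regular Cayley graph (SRCG) with Paley parameters if it is strongly regular with parameters $(\nu,(\nu-1)/2,(\nu-5)/4,(\nu-1)/4)$, where $\nu=|A|$ and these are non-negative integers. **Corollary 7.3.** (i) Let $A$ be a finite abelian group of rank $2$ (that is,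 whose minimal number of generators is $2$), and let $\Gamma_A(S)$ be an SRCG with Paley parameters. Then there are an odd prime $p$ and an integer $n\ge 1$ such that $A\cong \mathbb Z_{p^n}\oplus\mathbb Z_{p^n}$ and, for every isomorphism $e:A\to\mathbb Z_{p^n}\oplus\mathbb Z_{p^n}$, we have $e(S)=\bigcup_{H\in T}O_H$ for some $\left(\frac{p+1}2,\frac{p-1}2,\dots,\frac{p-1}2\right)$-homogeneous set $T\subseteq\Delta$. (ii) Conversely, for every odd prime $p$ and every $n\ge 1$, the group $G=\mathbb Z_{p^n}\oplus\mathbb Z_{p^n}$ has rank $2$, and for every $\left(\frac{p+1}2,\frac{p-1}2,\dots,\frac{p-1}2\right)$-homogeneous set $T\subseteq\Delta$ the graph $\Gamma_G\left(\bigcup_{H\in T}O_H\right)$ is an SRCG with Paley parameters. -/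

import Mathlib

namespace PaleyCayley

/-- The connection set `S` (symmetric, not containing `0`) gives a strongly regular Cayley graph
`Γ_A(S)` with Paley parameters `(ν, (ν - 1)/2, (ν - 5)/4, (ν - 1)/4)`. The three quotients are
required to be exact, so that no truncation occurs. -/
structure IsPaleySRCG {A : Type*} [AddCommGroup A] [Finite A] (S : Set A) : Prop where
  zero_notMem : (0 : A) ∉ S
  neg_mem : ∀ g ∈ S, -g ∈ S
  isSRG : ∃ k l m : ℕ, Nat.card A = 2 * k + 1 ∧ Nat.card A = 4 * l + 5 ∧ Nat.card A = 4 * m + 1 ∧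
    (letI : Fintype A := Fintype.ofFinite A
     letI : DecidableRel (SimpleGraph.addCayley S).Adj := Classical.decRel _
     (SimpleGraph.addCayley S).IsSRGWith (Nat.card A) k l m)

/-- The group `ℤ_{p^n} ⊕ ℤ_{p^n}`. -/
abbrev Grp (p n : ℕ) : Type := ZMod (p ^ n) × ZMod (p ^ n)

/-- The set `Δ` of all cyclic subgroups of `ℤ_{p^n} ⊕ ℤ_{p^n}`. -/
def Delta (p n : ℕ) : Set (AddSubgroup (Grp p n)) :=
  {H | IsAddCyclic H}

/-- `Father(H) = pH`. -/
def father {p n : ℕ} (H : AddSubgroup (Grp p n)) : AddSubgroup (Grp p n) :=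
  H.map (nsmulAddMonoidHom p)

/-- `Sons(H)`: the cyclic subgroups whose father is `H`. The trivial subgroup is its own father
under this formula; this does not matter below, since homogeneous sets do not contain it. -/
def sons {p n : ℕ} (H : AddSubgroup (Grp p n)) : Set (AddSubgroup (Grp p n)) :=
  {F | F ∈ Delta p n ∧ father F = H}

open Classical in
/-- `T ⊆ Δ` is an `(a₁, …, aₙ)`-homogeneous set, where `a i` (with `i : Fin n`) stands for
`a_{i+1}`. A cyclic subgroup `H` has length `i` if its order is `p ^ i`. -/
structure IsHomogeneous (p n : ℕ) (a : Fin n → ℕ) (T : Set (AddSubgroup (Grp p n))) : Prop where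
  bound : ∀ i : Fin n, a i ≤ if (i : ℕ) = 0 then p + 1 else p - 1
  subset : T ⊆ Delta p n
  bot_notMem : ⊥ ∉ T
  ncard_sons : ∀ H ∈ Delta p n, ∀ i : Fin n, Nat.card H = p ^ (i : ℕ) →
    (sons H ∩ T).ncard = if H ∈ T then a i + 1 else a i

/-- The union of the sets `O_H` of all generators of `H`, over `H ∈ T`. -/
def generatorSet {p n : ℕ} (T : Set (AddSubgroup (Grp p n))) : Set (Grp p n) :=
  ⋃ H ∈ T, {g | AddSubgroup.zmultiples g = H}

/-- The vector `((p + 1)/2, (p - 1)/2, …, (p - 1)/2)` of length `n`. -/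
def paleyVector (p n : ℕ) : Fin n → ℕ :=
  fun i => if (i : ℕ) = 0 then (p + 1) / 2 else (p - 1) / 2

end PaleyCayley

/-!
# Strongly regular Cayley graphs with Paley parameters over abelian groups of rank two

Let `f` be the sign function of the connection set `S`: `0` at `0`, `1` on `S` and `-1` elsewhere.
Then `S` is of Paley type iff `f` is even, has sum `0` and satisfies `f * f = ν δ₀ - 1`, where `ν` is
the order of the group (`IsPaleyFun`). Consequently `f ^ (2 k + 1) = ν ^ k f` in the group algebra.

Reading this identity modulo an odd prime `t`, where the `t`-th power is the Frobenius map
(`IsPaleyFun.frobenius`), replaces Galois theory of character values. If `t` does not divide `ν`,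
then `f (t x) = ± f x` with a sign independent of `x`; if `t` divides `ν`, then the sum of `f` over
every coset of the `t`-torsion is divisible by `t`. If moreover the `p`-torsion has order `p ^ 2`
and `f` is constant on its punctured lines, then a parity argument together with the sum of squares
of the coset sums shows that these sums are `± p` off the torsion and `0` on it
(`IsPaleyFun.fiber`).

A group of rank two with a Paley function is therefore a `p`-group: for primes `p ≥ 5` and `q ≠ p`
dividing `ν`, the coset `x + A[p]` of an element `x` of order `q` has sum
`± 1 + (p - 1) * (an even number)`, which is never `± p` (`IsPaleyFun.eq_of_prime_dvd_card`). If a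
rank two `p`-group of exponent `N p` is not homocyclic, then `N A` is of order `p`, and `f` is
invariant under translation by `N A` outside the kernel of multiplication by `N`; the value of
`f * f` at a nonzero element of `N A` is then too large
(`IsPaleyFun.false_of_range_le_zmultiples`). So the group is `G = ℤ_{p^n} ⊕ ℤ_{p^n}`.

On `G` let `h (p c)` be the sum of `f` over `c + G[p]`, divided by `p`. For the symplectic Fourier
transform `f̂` and `a` of order `p ^ n`, one has
`(p - 1) f̂(a) = (p - 1) p^n f(a) + ∑ u, (f - h)(u p a)`
(`UnitInvariant.sub_one_mul_sympFourier_of_primitive`). For a Paley function `f̂(a) = ± p^n`, and the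
size of the sum forces it to vanish; descending along the multiples of `a` gives `f = h` on `p G`.
Conversely, if `f = h` then `f̂ = p^n f` (`UnitInvariant.sympFourier_eq`), and Fourier inversion
gives `f * f = ν δ₀ - 1`. Finally `f = h` says precisely that the set of cyclic subgroups on which
`f = 1` is homogeneous for the Paley vector (`isHomogeneous_iff`), by counting generators of sons.
-/

namespace PaleyCayley

open Finset

/-! ### Sign functions of Paley type connection sets -/

section Basic

variable {A : Type*} [AddCommGroup A] [Fintype A] [DecidableEq A]

/-- `f` is an even function with values `± 1` off `0`, with `f 0 = 0` and sum zero, whose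
autocorrelation is `ν δ₀ - 1`. These are the sign functions of Paley type connection sets. -/
structure IsPaleyFun (f : A → ℤ) : Prop where
  map_zero : f 0 = 0
  sign : ∀ x, x ≠ 0 → f x = 1 ∨ f x = -1
  map_neg : ∀ x, f (-x) = f x
  sum_eq_zero : ∑ x, f x = 0
  corr : ∀ z, ∑ x, f x * f (x + z) = (if z = 0 then (Fintype.card A : ℤ) else 0) - 1

open Classical in
/-- The sign function of `S`: `1` on `S` and `-1` off `S`, except for the value `0` at `0`. -/
noncomputable def signFun (S : Set A) (x : A) : ℤ :=
  if x = 0 then 0 else if x ∈ S then 1 else -1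

omit [Fintype A] [DecidableEq A] in
theorem addCayley_adj_iff {S : Set A} (h0 : (0 : A) ∉ S) (hneg : ∀ g ∈ S, -g ∈ S) (u v : A) :
    (SimpleGraph.addCayley S).Adj u v ↔ v - u ∈ S := by
  rw [SimpleGraph.addCayley_adj']
  constructor
  · rintro ⟨-, g, hg, h | h⟩
    · rw [← h]; simpa using hg
    · rw [h]; simpa using hneg g hg
  · intro h
    refine ⟨?_, v - u, h, Or.inl (by abel)⟩
    rintro rfl
    exact h0 (by simpa using h)

omit [Fintype A] in
theorem signFun_eq {S : Set A} (h0 : (0 : A) ∉ S) [DecidablePred (· ∈ S)] (x : A) :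
    signFun S x = 2 * (if x ∈ S then 1 else 0) - 1 + (if x = 0 then 1 else 0) := by
  unfold signFun
  by_cases hx : x = 0
  · simp [hx, h0]
  · by_cases hS : x ∈ S <;> simp [hx, hS]

theorem sum_signFun {S : Set A} (h0 : (0 : A) ∉ S) :
    ∑ x, signFun S x = 2 * (S.ncard : ℤ) - Fintype.card A + 1 := by
  classical
  have hc : S.ncard = #{x | x ∈ S} := by
    rw [← Set.ncard_coe_finset]; simp
  simp only [signFun_eq h0, sum_add_distrib, sum_sub_distrib, ← mul_sum, hc]
  simp [Finset.sum_boole]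

/-- The autocorrelation of the sign function counts common neighbours. -/
theorem corr_signFun {S : Set A} (h0 : (0 : A) ∉ S) (hneg : ∀ g ∈ S, -g ∈ S) {z : A}
    (hz : z ≠ 0) [Decidable (z ∈ S)] :
    ∑ x, signFun S x * signFun S (x + z) = 4 * ({x | x ∈ S ∧ x + z ∈ S}.ncard : ℤ)
      - 4 * (S.ncard : ℤ) + Fintype.card A + (if z ∈ S then 4 else 0) - 2 := by
  classical
  have hS : ∀ x, -x ∈ S ↔ x ∈ S := fun x => ⟨fun h => by simpa using hneg _ h, hneg x⟩
  have hc : S.ncard = #{x | x ∈ S} := by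
    rw [← Set.ncard_coe_finset]; simp
  have hc' : {x | x ∈ S ∧ x + z ∈ S}.ncard = #{x | x ∈ S ∧ x + z ∈ S} := by
    rw [← Set.ncard_coe_finset]; simp
  have key : ∀ x, signFun S x * signFun S (x + z) =
      4 * (if x ∈ S ∧ x + z ∈ S then 1 else 0) - 2 * (if x ∈ S then 1 else 0)
      - 2 * (if x + z ∈ S then 1 else 0) + 1
      + (if x = 0 then (if z ∈ S then 2 else 0) - 1 else 0)
      + (if x = -z then (if z ∈ S then 2 else 0) - 1 else 0) := by
    intro x
    rw [signFun_eq h0, signFun_eq h0]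
    by_cases hx : x = 0
    · subst hx
      have : ¬ (0 = -z) := by simpa [eq_comm] using hz
      simp [h0, hz, this]
    · by_cases hxz : x = -z
      · subst hxz
        simp [hz, h0, hS]
      · have : x + z ≠ 0 := fun h => hxz (eq_neg_of_add_eq_zero_left h)
        by_cases h1 : x ∈ S <;> by_cases h2 : x + z ∈ S <;> simp [hx, hxz, this, h1, h2]
  have hshift : #{x | x + z ∈ S} = #{x | x ∈ S} := by
    refine Finset.card_bij (fun x _ => x + z) (by simp) (by simp) ?_
    intro y hy
    exact ⟨y - z, by simpa using hy, by simp⟩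
  simp only [key, sum_add_distrib, sum_sub_distrib, ← mul_sum, Finset.sum_ite_eq', Finset.sum_boole,
    Finset.mem_univ, if_true, hshift, hc, hc']
  split_ifs <;> simp <;> ring

theorem signFun_sq (S : Set A) : ∑ x, signFun S x * signFun S x = Fintype.card A - 1 := by
  have : ∀ x, signFun S x * signFun S x = 1 - (if x = 0 then 1 else 0) := by
    intro x
    simp only [signFun]
    split_ifs <;> simp
  simp [this]

omit [Fintype A] [DecidableEq A] in
theorem card_commonNeighbors {S : Set A} (h0 : (0 : A) ∉ S) (hneg : ∀ g ∈ S, -g ∈ S) (v w : A)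
    [Fintype ((SimpleGraph.addCayley S).commonNeighbors v w)] :
    Fintype.card ((SimpleGraph.addCayley S).commonNeighbors v w) =
      {x | x ∈ S ∧ x + (v - w) ∈ S}.ncard := by
  rw [← Nat.card_eq_fintype_card, Nat.card_coe_set_eq]
  refine Set.ncard_congr (fun x _ => x - v) ?_ (by simp) ?_
  · intro x hx
    simp only [SimpleGraph.mem_commonNeighbors, addCayley_adj_iff h0 hneg] at hx
    simpa using hx
  · intro y hy
    refine ⟨y + v, ?_, by simp⟩
    simp only [SimpleGraph.mem_commonNeighbors, addCayley_adj_iff h0 hneg]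
    simpa [add_sub_assoc] using hy

omit [Fintype A] [DecidableEq A] in
theorem degree_addCayley {S : Set A} (h0 : (0 : A) ∉ S) (hneg : ∀ g ∈ S, -g ∈ S) (v : A)
    [Fintype ((SimpleGraph.addCayley S).neighborSet v)] :
    (SimpleGraph.addCayley S).degree v = S.ncard := by
  rw [← SimpleGraph.card_neighborSet_eq_degree, ← Nat.card_eq_fintype_card, Nat.card_coe_set_eq]
  refine Set.ncard_congr (fun x _ => x - v) ?_ (by simp) ?_
  · intro x hx
    simpa [addCayley_adj_iff h0 hneg] using hx
  · intro y hy
    exact ⟨y + v, by simpa [addCayley_adj_iff h0 hneg] using hy, by simp⟩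

theorem IsPaleySRCG.isPaleyFun {S : Set A} (h : IsPaleySRCG S) : IsPaleyFun (signFun S) := by
  classical
  obtain ⟨h0, hneg, k, l, m, hk, hl, hm, hs⟩ := h
  have hS : ∀ x, -x ∈ S ↔ x ∈ S := fun x => ⟨fun h => by simpa using hneg _ h, hneg x⟩
  rw [Nat.card_eq_fintype_card] at hk hl hm
  replace hs : (SimpleGraph.addCayley S).IsSRGWith (Nat.card A) k l m := by
    convert hs
  have hdeg : S.ncard = k := by
    rw [← hs.regular 0, degree_addCayley h0 hneg]
  refine ⟨by simp [signFun], ?_, ?_, ?_, ?_⟩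
  · intro x hx
    unfold signFun
    by_cases h : x ∈ S <;> simp [hx, h]
  · intro x
    simp [signFun, hS]
  · rw [sum_signFun h0, hdeg, hk]
    push_cast
    ring
  · intro z
    by_cases hz : z = 0
    · subst hz
      simp only [add_zero, if_true]
      exact signFun_sq S
    · rw [corr_signFun h0 hneg hz, hdeg]
      by_cases hzS : z ∈ S
      · have h1 := hs.of_adj z 0 (by rw [addCayley_adj_iff h0 hneg]; simpa [hS] using hzS)
        rw [card_commonNeighbors h0 hneg, sub_zero] at h1
        simp only [hz, hzS, if_true, if_false, h1]
        omega
      · have h1 := hs.of_not_adj (i := z) (j := 0) hz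
          (by rw [addCayley_adj_iff h0 hneg]; simpa [hS] using hzS)
        rw [card_commonNeighbors h0 hneg, sub_zero] at h1
        simp only [hz, hzS, if_false, h1]
        omega

theorem IsPaleyFun.isPaleySRCG {S : Set A} (h0 : (0 : A) ∉ S)
    (h : IsPaleyFun (signFun S)) {l : ℕ} (hl : Fintype.card A = 4 * l + 5) : IsPaleySRCG S := by
  classical
  have hneg : ∀ g ∈ S, -g ∈ S := by
    intro g hg
    have hg0 : g ≠ 0 := by rintro rfl; exact h0 hg
    have := h.map_neg g
    by_contra hn
    simp [signFun, hg0, hg, hn] at this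
  have hS : ∀ x, -x ∈ S ↔ x ∈ S := fun x => ⟨fun h => by simpa using hneg _ h, hneg x⟩
  have hk : S.ncard = 2 * l + 2 := by
    have := sum_signFun h0
    rw [h.sum_eq_zero] at this
    omega
  have hcorr : ∀ z, z ≠ 0 → {x | x ∈ S ∧ x + z ∈ S}.ncard + (if z ∈ S then 1 else 0) = l + 1 := by
    intro z hz
    have h1 := corr_signFun h0 hneg hz
    rw [h.corr, if_neg hz, hk] at h1
    split_ifs at h1 ⊢ <;> omega
  have hcard := Nat.card_eq_fintype_card (α := A)
  refine ⟨h0, hneg, 2 * l + 2, l, l + 1, by omega, by omega, by omega, ?_⟩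
  suffices h : (SimpleGraph.addCayley S).IsSRGWith (Nat.card A) (2 * l + 2) l (l + 1) by
    convert h
  refine ⟨Nat.card_eq_fintype_card.symm, ?_, ?_, ?_⟩
  · intro v
    rw [degree_addCayley h0 hneg, ← hk]
  · intro v w hvw
    have hne : v - w ≠ 0 := sub_ne_zero.mpr hvw.ne
    rw [addCayley_adj_iff h0 hneg, ← hS, neg_sub] at hvw
    have := hcorr _ hne
    rw [if_pos hvw] at this
    rw [card_commonNeighbors h0 hneg]
    omega
  · intro v w hne hvw
    have hne : v - w ≠ 0 := sub_ne_zero.mpr hne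
    rw [addCayley_adj_iff h0 hneg, ← hS, neg_sub] at hvw
    have := hcorr _ hne
    rw [if_neg hvw] at this
    rw [card_commonNeighbors h0 hneg]
    omega

end Basic

/-! ### Multipliers and the Frobenius map of the group algebra -/

section Multipliers

variable {A : Type*} [AddCommGroup A] [Fintype A] [DecidableEq A] {f : A → ℤ}

theorem IsPaleyFun.conv (hf : IsPaleyFun f) (z : A) :
    ∑ x, f x * f (z - x) = (if z = 0 then (Fintype.card A : ℤ) else 0) - 1 := by
  have h := hf.corr (-z)
  simp only [neg_eq_zero] at h
  rw [← h]
  refine Finset.sum_congr rfl fun x _ => ?_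
  rw [← hf.map_neg (z - x)]
  congr 2
  abel

/-- The element `∑ f(x) X^x` of the group algebra over a commutative ring. -/
noncomputable def groupElt (R : Type*) [CommRing R] (f : A → ℤ) : AddMonoidAlgebra R A :=
  ∑ x, AddMonoidAlgebra.single x (f x : R)

omit [AddCommGroup A] in
theorem coeff_groupElt (R : Type*) [CommRing R] (f : A → ℤ) (x : A) :
    (groupElt R f).coeff x = f x := by
  simp [groupElt, Finsupp.single_apply]

theorem groupElt_mul (R : Type*) [CommRing R] (f g : A → ℤ) :
    groupElt R f * groupElt R g = groupElt R (fun z => ∑ x, f x * g (z - x)) := by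
  simp only [groupElt, Finset.sum_mul_sum, AddMonoidAlgebra.single_mul_single]
  have h : ∀ x, ∑ y, AddMonoidAlgebra.single (x + y) ((f x : R) * (g y : R)) =
      ∑ z, AddMonoidAlgebra.single z ((f x : R) * (g (z - x) : R)) := fun x =>
    Fintype.sum_equiv (Equiv.addLeft x) _ _ (by simp)
  simp only [h]
  rw [Finset.sum_comm]
  refine Finset.sum_congr rfl fun z _ => ?_
  ext w
  by_cases hw : z = w <;> simp [hw]

theorem IsPaleyFun.groupElt_pow (hf : IsPaleyFun f) (R : Type*) [CommRing R] (k : ℕ) :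
    groupElt R f ^ (2 * k + 1) = groupElt R (fun x => (Fintype.card A : ℤ) ^ k * f x) := by
  induction k with
  | zero => simp
  | succ k ih =>
    rw [show 2 * (k + 1) + 1 = (2 * k + 1) + 2 by ring, pow_add, ih, pow_two, groupElt_mul R f f,
      groupElt_mul]
    simp only [hf.conv]
    congr 1
    ext z
    simp only [mul_sub, sum_sub_distrib, mul_ite, mul_zero, sub_eq_zero (a := z), eq_comm (a := z),
      Finset.sum_ite_eq', mem_univ, if_true, mul_one, ← mul_sum, hf.sum_eq_zero]
    simp
    ring

/-- The `t`-th power of `∑ f(x) X^x` in characteristic `t`, computed in two ways: by the Frobenius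
map, and by `f ^ t = ν ^ (t / 2) f`. -/
theorem IsPaleyFun.frobenius (hf : IsPaleyFun f) {t : ℕ} [Fact t.Prime] (ht : Odd t) (x : A) :
    ((∑ y with t • y = x, f y : ℤ) : ZMod t) = (Fintype.card A : ZMod t) ^ (t / 2) * f x := by
  have : CharP (AddMonoidAlgebra (ZMod t) A) t := by
    rw [← Algebra.charP_iff (ZMod t) _ t]
    exact ZMod.charP t
  have h1 := hf.groupElt_pow (ZMod t) (t / 2)
  rw [Nat.two_mul_div_two_add_one_of_odd ht] at h1
  have h2 := congrArg (fun e => e.coeff x) h1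
  simp only [coeff_groupElt] at h2
  push_cast at h2 ⊢
  rw [← h2, groupElt, sum_pow_char]
  simp [AddMonoidAlgebra.single_pow, Finsupp.single_apply, ZMod.pow_card, Finset.sum_filter]

theorem eq_of_sign_cast_eq {t : ℕ} (ht : 2 < t) {a b : ℤ} (ha : a = 1 ∨ a = -1 ∨ a = 0)
    (hb : b = 1 ∨ b = -1 ∨ b = 0) (h : (a : ZMod t) = b) : a = b := by
  rw [ZMod.intCast_eq_intCast_iff_dvd_sub] at h
  by_contra hne
  have h1 := Nat.le_of_dvd (by omega) (Int.natCast_dvd.1 h)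
  omega

theorem IsPaleyFun.sign_or_zero (hf : IsPaleyFun f) (x : A) : f x = 1 ∨ f x = -1 ∨ f x = 0 := by
  by_cases hx : x = 0
  · simp [hx, hf.map_zero]
  · rcases hf.sign x hx with h | h <;> simp [h]

theorem IsPaleyFun.prime_multiplier (hf : IsPaleyFun f) {t : ℕ} (hp : t.Prime) (ht : Odd t)
    (hc : t.Coprime (Fintype.card A)) :
    ∃ ε : ℤ, (ε = 1 ∨ ε = -1) ∧ (IsSquare (Fintype.card A) → ε = 1) ∧
      ∀ x, f (t • x) = ε * f x := by
  have : Fact t.Prime := ⟨hp⟩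
  have ht2 : 2 < t := by
    rcases hp.two_le.lt_or_eq with h | h
    · exact h
    · subst h; exact absurd ht (by decide)
  have hν : (Fintype.card A : ZMod t) ≠ 0 := by
    rw [Ne, ZMod.natCast_eq_zero_iff]
    exact fun h => hp.one_lt.ne' (Nat.Coprime.eq_one_of_dvd hc h)
  have hfr : ∀ x, (f x : ZMod t) = (Fintype.card A : ZMod t) ^ (t / 2) * f (t • x) := by
    intro x
    rw [← hf.frobenius ht]
    congr 2
    rw [Finset.sum_eq_single_of_mem x (by simp)]
    intro y hy hne
    exfalso
    apply hne
    simp only [mem_filter, mem_univ, true_and] at hy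
    have hinj := (Nat.Coprime.nsmul_right_bijective (G := A) (n := t)
      (by rw [Nat.card_eq_fintype_card]; exact hc.symm)).1
    exact hinj hy
  rcases ZMod.pow_div_two_eq_neg_one_or_one t hν with h | h
  · refine ⟨1, Or.inl rfl, fun _ => rfl, fun x => ?_⟩
    have := hfr x
    rw [h, one_mul] at this
    rw [one_mul]
    exact (eq_of_sign_cast_eq ht2 (hf.sign_or_zero _) (hf.sign_or_zero _) this).symm
  · refine ⟨-1, Or.inr rfl, ?_, fun x => ?_⟩
    · rintro ⟨m, hm⟩
      exfalso
      have hm0 : (m : ZMod t) ≠ 0 := by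
        intro h0
        apply hν
        rw [hm]; push_cast; rw [h0, zero_mul]
      have : (Fintype.card A : ZMod t) ^ (t / 2) = 1 := by
        rw [hm]; push_cast
        rw [← pow_two, ← pow_mul, show 2 * (t / 2) = t - 1 by
          have := Nat.two_mul_div_two_add_one_of_odd ht; omega]
        exact ZMod.pow_card_sub_one_eq_one hm0
      rw [this] at h
      have h' : ((1 : ℤ) : ZMod t) = ((-1 : ℤ) : ZMod t) := by simpa using h
      have := eq_of_sign_cast_eq ht2 (Or.inl rfl) (Or.inr (Or.inl rfl)) h'
      omega
    · have h3 := hfr x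
      rw [h] at h3
      have h4 : (f x : ZMod t) = ((-f (t • x) : ℤ) : ZMod t) := by rw [h3]; push_cast; ring
      have h5 := eq_of_sign_cast_eq ht2 (hf.sign_or_zero _)
        (by have := hf.sign_or_zero (t • x); omega) h4
      omega

/-- Every odd `t` prime to the order multiplies `f` by a global sign. This sign is the Jacobi symbol
of the order modulo `t`; only its value for square orders is needed. -/
theorem IsPaleyFun.multiplier (hf : IsPaleyFun f) {t : ℕ} (ht : Odd t)
    (hc : t.Coprime (Fintype.card A)) :
    ∃ ε : ℤ, (ε = 1 ∨ ε = -1) ∧ (IsSquare (Fintype.card A) → ε = 1) ∧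
      ∀ x, f (t • x) = ε * f x := by
  induction t using Nat.recOnMul with
  | zero => simp at ht
  | one => exact ⟨1, Or.inl rfl, fun _ => rfl, by simp⟩
  | prime p hp => exact hf.prime_multiplier hp ht hc
  | mul a b iha ihb =>
    rw [Nat.odd_mul] at ht
    obtain ⟨ε, h1, h2, h3⟩ := iha ht.1 (Nat.Coprime.coprime_mul_right hc)
    obtain ⟨η, g1, g2, g3⟩ := ihb ht.2 (Nat.Coprime.coprime_mul_left hc)
    refine ⟨ε * η, ?_, fun hs => by rw [h2 hs, g2 hs, one_mul], fun x => ?_⟩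
    · rcases h1 with rfl | rfl <;> rcases g1 with rfl | rfl <;> simp
    · rw [mul_smul, h3, g3, mul_assoc]

/-- If `t` fixes some nonzero element, then the sign by which `t` multiplies `f` is `1`. -/
theorem IsPaleyFun.map_nsmul (hf : IsPaleyFun f) {t : ℕ} (ht : Odd t)
    (hc : t.Coprime (Fintype.card A)) {y : A} (hy : y ≠ 0) (hty : t • y = y) (x : A) :
    f (t • x) = f x := by
  obtain ⟨ε, h1, -, h3⟩ := hf.multiplier ht hc
  have := h3 y
  rw [hty] at this
  have hε : ε = 1 := by
    rcases h1 with h | h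
    · exact h
    · have := hf.sign y hy
      subst h
      omega
  rw [h3, hε, one_mul]

theorem IsPaleyFun.map_nsmul_of_isSquare (hf : IsPaleyFun f) (hs : IsSquare (Fintype.card A))
    {t : ℕ} (ht : Odd t) (hc : t.Coprime (Fintype.card A)) (x : A) : f (t • x) = f x := by
  obtain ⟨ε, -, h2, h3⟩ := hf.multiplier ht hc
  rw [h3, h2 hs, one_mul]

/-- The fibre of multiplication by `p` through `c` is the coset `c + A[p]`. -/
theorem sum_fiber_eq {p : ℕ} (c : A) :
    ∑ y with p • y = p • c, f y = ∑ z with p • z = 0, f (c + z) := by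
  symm
  refine Finset.sum_bij (fun z _ => c + z) ?_ (by simp) ?_ (by simp)
  · intro z hz
    simp only [mem_filter, mem_univ, true_and] at hz ⊢
    rw [smul_add, hz, add_zero]
  · intro y hy
    simp only [mem_filter, mem_univ, true_and] at hy
    exact ⟨y - c, by simp [smul_sub, hy], by simp⟩

theorem IsPaleyFun.dvd_sum_fiber (hf : IsPaleyFun f) {p : ℕ} (hp : p.Prime) (ho : Odd p)
    (hd : p ∣ Fintype.card A) (c : A) : (p : ℤ) ∣ ∑ z with p • z = 0, f (c + z) := by
  have : Fact p.Prime := ⟨hp⟩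
  rw [← sum_fiber_eq, ← ZMod.intCast_zmod_eq_zero_iff_dvd, hf.frobenius ho,
    (ZMod.natCast_eq_zero_iff _ _).2 hd, zero_pow, zero_mul]
  obtain ⟨k, rfl⟩ := ho
  have := hp.two_le
  omega

end Multipliers

/-! ### Sums over `p`-torsion cosets -/

section Torsion

variable {A : Type*} [AddCommGroup A] [Fintype A] [DecidableEq A] {f : A → ℤ}

open Classical in
omit [DecidableEq A] in
theorem card_generators (x : A) :
    #{y | AddSubgroup.zmultiples y = AddSubgroup.zmultiples x} = (addOrderOf x).totient := by
  classical
  have h := IsAddCyclic.card_addOrderOf_eq_totient (α := AddSubgroup.zmultiples x)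
    (d := addOrderOf x)
    (by rw [← Nat.card_eq_fintype_card, Nat.card_zmultiples])
  rw [← h]
  symm
  refine Finset.card_bij (fun y _ => (y : A)) ?_ (by simp) ?_
  · rintro ⟨y, hy⟩ hyo
    simp only [mem_filter, mem_univ, true_and, AddSubgroup.addOrderOf_mk] at hyo ⊢
    refine AddSubgroup.eq_of_le_of_card_ge (by simpa using hy) ?_
    rw [Nat.card_zmultiples, Nat.card_zmultiples, hyo]
  · intro y hy
    simp only [mem_filter, mem_univ, true_and] at hy
    refine ⟨⟨y, hy ▸ AddSubgroup.mem_zmultiples y⟩, ?_, rfl⟩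
    simp only [mem_filter, mem_univ, true_and, AddSubgroup.addOrderOf_mk]
    rw [← Nat.card_zmultiples, ← Nat.card_zmultiples, hy]

omit [Fintype A] [DecidableEq A] in
theorem exists_coprime_nsmul {p : ℕ} (hp : p.Prime) {x y : A} (hx : p • x = 0)
    (h : AddSubgroup.zmultiples x = AddSubgroup.zmultiples y) (hx0 : x ≠ 0) :
    ∃ s : ℕ, s.Coprime p ∧ y = s • x := by
  have hy : y ∈ AddSubgroup.zmultiples x := h ▸ AddSubgroup.mem_zmultiples y
  have : Fact p.Prime := ⟨hp⟩
  have ho : addOrderOf x = p := addOrderOf_eq_prime hx hx0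
  have hfin : IsOfFinAddOrder x := isOfFinAddOrder_iff_nsmul_eq_zero.2 ⟨p, hp.pos, hx⟩
  rw [← hfin.mem_multiples_iff_mem_zmultiples, AddSubmonoid.mem_multiples_iff] at hy
  obtain ⟨s, rfl⟩ := hy
  refine ⟨s, ?_, rfl⟩
  rw [Nat.coprime_comm, hp.coprime_iff_not_dvd]
  intro hd
  rw [addOrderOf_dvd_iff_nsmul_eq_zero.1 (ho ▸ hd)] at h
  simp at h
  exact hx0 h

omit [DecidableEq A] in
/-- A set of elements of order `p` closed under scaling is a disjoint union of punctured lines. -/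
theorem dvd_card_of_scaling {p : ℕ} (hp : p.Prime) {X : Finset A} (h0 : (0 : A) ∉ X)
    (hX : ∀ x ∈ X, p • x = 0) (hs : ∀ x ∈ X, ∀ s : ℕ, s.Coprime p → s • x ∈ X) :
    p - 1 ∣ #X := by
  classical
  rw [Finset.card_eq_sum_card_image AddSubgroup.zmultiples X]
  refine Finset.dvd_sum fun F hF => ?_
  obtain ⟨x, hx, rfl⟩ := Finset.mem_image.1 hF
  have hx0 : x ≠ 0 := by rintro rfl; exact h0 hx
  have ho : addOrderOf x = p := by
    have : Fact p.Prime := ⟨hp⟩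
    exact addOrderOf_eq_prime (hX x hx) hx0
  have : #{y ∈ X | AddSubgroup.zmultiples y = AddSubgroup.zmultiples x} = p - 1 := by
    rw [← Nat.totient_prime hp, ← ho, ← card_generators x]
    congr 1
    ext y
    simp only [mem_filter, mem_univ, true_and, and_iff_right_iff_imp]
    intro hy
    obtain ⟨s, hs', rfl⟩ := exists_coprime_nsmul hp (hX x hx) hy.symm hx0
    exact hs x hx s hs'
  rw [this]

theorem sum_sign {ι : Type*} (s : Finset ι) {g : ι → ℤ} (hg : ∀ z ∈ s, g z = 1 ∨ g z = -1) :
    ∑ z ∈ s, g z = 2 * #{z ∈ s | g z = 1} - #s := by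
  have h2 : ∑ z ∈ s, g z = ∑ z ∈ s, (2 * (if g z = 1 then 1 else 0) - 1) := by
    refine Finset.sum_congr rfl fun z hz => ?_
    rcases hg z hz with h | h <;> simp [h]
  rw [h2, sum_sub_distrib, ← mul_sum, Finset.sum_boole]
  simp

/-- The sum over the `p`-torsion of a function with values `± 1` that is constant on punctured
lines: `m` is the number of lines, and `k` the number of those on which the function is `1`. -/
theorem sum_torsion {p : ℕ} (hp : p.Prime) {g : A → ℤ}
    (hg : ∀ z, p • z = 0 → z ≠ 0 → g z = 1 ∨ g z = -1)
    (hs : ∀ z, p • z = 0 → z ≠ 0 → ∀ s : ℕ, s.Coprime p → g (s • z) = g z) {m : ℕ}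
    (hm : #{z : A | p • z = 0} = (p - 1) * m + 1) :
    ∃ k ≤ m, ∑ z with p • z = 0, g z = g 0 + (p - 1) * (2 * k - m) := by
  have hne : ∀ z : A, p • z = 0 → z ≠ 0 → ∀ s : ℕ, s.Coprime p → s • z ≠ 0 := by
    intro z hz hz0 s hsp h
    have : Fact p.Prime := ⟨hp⟩
    have ho : addOrderOf z = p := addOrderOf_eq_prime hz hz0
    have h1 := addOrderOf_dvd_of_nsmul_eq_zero h
    rw [ho] at h1
    exact hp.one_lt.ne' (Nat.Coprime.eq_one_of_dvd hsp.symm h1)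
  obtain ⟨k, hk⟩ := dvd_card_of_scaling hp (X := {z : A | p • z = 0 ∧ z ≠ 0 ∧ g z = 1}) (by simp)
    (by simp +contextual) (by
      intro x hx s hsp
      simp only [mem_filter, mem_univ, true_and] at hx ⊢
      refine ⟨by rw [smul_comm, hx.1, smul_zero], hne x hx.1 hx.2.1 s hsp, ?_⟩
      rw [hs x hx.1 hx.2.1 s hsp, hx.2.2])
  have hcard : #{z : A | p • z = 0 ∧ z ≠ 0} = (p - 1) * m := by
    have : ({z : A | p • z = 0 ∧ z ≠ 0} : Finset A) = {z : A | p • z = 0}.toFinset.erase 0 := by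
      ext; simp [and_comm]
    rw [this, Finset.card_erase_of_mem (by simp)]
    simp [hm]
  have hp1 : 0 < p - 1 := by have := hp.two_le; omega
  refine ⟨k, ?_, ?_⟩
  · refine Nat.le_of_mul_le_mul_left ?_ hp1
    rw [← hk, ← hcard]
    exact Finset.card_le_card fun z => by simp +contextual
  · have h1 : ∑ z with p • z = 0, g z = g 0 + ∑ z with p • z = 0 ∧ z ≠ 0, g z := by
      have : ({z : A | p • z = 0} : Finset A) =
          insert 0 ({z : A | p • z = 0 ∧ z ≠ 0} : Finset A) := by
        ext z
        by_cases hz : z = 0 <;> simp [hz]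
      rw [this, Finset.sum_insert (by simp)]
    have : ((p - 1 : ℕ) : ℤ) = p - 1 := by rw [Nat.cast_sub hp.one_le]; simp
    rw [h1, sum_sign _ (fun z hz => by
      simp only [mem_filter, mem_univ, true_and] at hz
      exact hg z hz.1 hz.2), Finset.filter_filter, hcard]
    simp only [and_assoc, hk]
    push_cast [this]
    ring

theorem IsPaleyFun.sum_sq_fiber (hf : IsPaleyFun f) (p : ℕ) :
    ∑ c, (∑ z with p • z = 0, f (c + z)) ^ 2 =
      #{z : A | p • z = 0} * ((Fintype.card A : ℤ) - #{z : A | p • z = 0}) := by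
  have h : ∀ c, (∑ z with p • z = 0, f (c + z)) ^ 2 =
      ∑ z with p • z = 0, ∑ w with p • w = 0, f (c + z) * f (c + w) := by
    intro c
    rw [pow_two, Finset.sum_mul_sum]
  have h2 : ∀ z : A, p • z = 0 → ∑ w with p • w = 0, ∑ c, f (c + z) * f (c + w) =
      (Fintype.card A : ℤ) - #{z : A | p • z = 0} := by
    intro z hz
    have : ∀ w, ∑ c, f (c + z) * f (c + w) = (if w = z then (Fintype.card A : ℤ) else 0) - 1 := by
      intro w
      have := hf.corr (w - z)
      simp only [sub_eq_zero] at this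
      rw [← this]
      exact Fintype.sum_equiv (Equiv.addRight z) _ _ fun c => by
        rw [Equiv.coe_addRight, add_assoc, add_sub_cancel]
    simp only [this, sum_sub_distrib]
    simp [hz]
  simp only [h]
  rw [Finset.sum_comm]
  rw [← nsmul_eq_mul, ← sum_const]
  refine Finset.sum_congr rfl fun z hz => ?_
  rw [Finset.sum_comm]
  exact h2 z (by simpa using hz)

/-- The sums of `f` over the cosets of a `p`-torsion subgroup of order `p ^ 2`. They are divisible
by `p`, and odd off the torsion; since their squares add up to `p ^ 2 (ν - p ^ 2)`, there is no room
for anything but `± p`. -/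
theorem IsPaleyFun.fiber (hf : IsPaleyFun f) {p : ℕ} (hp : p.Prime) (ho : Odd p)
    (hcard : #{z : A | p • z = 0} = p ^ 2)
    (hs : ∀ z, p • z = 0 → ∀ s : ℕ, s.Coprime p → f (s • z) = f z) :
    (∑ z with p • z = 0, f z = 0) ∧
      ∀ c, p • c ≠ 0 → (∑ z with p • z = 0, f (c + z)) ^ 2 = p ^ 2 := by
  have hd : p ∣ Fintype.card A := by
    have h : p ∣ p ^ 2 := dvd_pow_self p two_ne_zero
    have : Fact p.Prime := ⟨hp⟩
    by_contra hnd
    have hinj := (Nat.Coprime.nsmul_right_bijective (G := A) (n := p)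
      (by rw [Nat.card_eq_fintype_card]; exact ((hp.coprime_iff_not_dvd).2 hnd).symm)).1
    have : ({z : A | p • z = 0} : Finset A) = {0} := by
      ext z
      simp only [mem_filter, mem_univ, true_and, mem_singleton]
      exact ⟨fun h => hinj (by simpa using h), fun h => by simp [h]⟩
    rw [this] at hcard
    simp at hcard
    have := hp.one_lt
    nlinarith
  have h0 : ∑ z with p • z = 0, f z = 0 := by
    obtain ⟨k, hk, h⟩ := sum_torsion hp (g := f) (m := p + 1) (fun z _ => hf.sign z)
      (fun z hz _ => hs z hz) (by
        rw [hcard]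
        obtain ⟨q, rfl⟩ : ∃ q, p = q + 1 := ⟨p - 1, by have := hp.pos; omega⟩
        simp; ring)
    rw [hf.map_zero, zero_add] at h
    have hdv := hf.dvd_sum_fiber hp ho hd 0
    simp only [zero_add] at hdv
    rw [h] at hdv
    -- `2 k - (p + 1)` is even, divisible by `p` and at most `p + 1` in absolute value
    have hcop : IsCoprime (p : ℤ) (p - 1) := ⟨1, -1, by ring⟩
    obtain ⟨j, hj⟩ := hcop.dvd_of_dvd_mul_left hdv
    have hp3 : (3 : ℤ) ≤ p := by
      obtain ⟨q, hq⟩ := ho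
      have := hp.two_le
      omega
    have hk' : (k : ℤ) ≤ p + 1 := by exact_mod_cast hk
    push_cast at hj
    have hj2 : j < 2 := by
      by_contra hcon
      nlinarith
    have hj3 : -2 < j := by
      by_contra hcon
      nlinarith
    have hj4 : j = 0 := by
      obtain ⟨q, rfl⟩ := ho
      interval_cases j <;> first | rfl | (exfalso; push_cast at hj; omega)
    rw [h]
    push_cast
    rw [hj, hj4]
    simp
  refine ⟨h0, ?_⟩
  have hzero : ∀ c, p • c = 0 → ∑ z with p • z = 0, f (c + z) = 0 := by
    intro c hc
    rw [← sum_fiber_eq, hc, h0]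
  have hge : ∀ c, p • c ≠ 0 → (p : ℤ) ^ 2 ≤ (∑ z with p • z = 0, f (c + z)) ^ 2 := by
    intro c hc
    obtain ⟨j, hj⟩ := hf.dvd_sum_fiber hp ho hd c
    have hodd : Odd (∑ z with p • z = 0, f (c + z)) := by
      rw [sum_sign, hcard]
      · push_cast
        exact Even.sub_odd (even_two_mul _) (by exact_mod_cast ho.pow)
      · intro z hz
        simp only [mem_filter, mem_univ, true_and] at hz
        exact hf.sign (c + z) (fun h => hc (by
          have := congrArg (p • ·) h
          simpa [smul_add, hz] using this))
    have hj0 : j ≠ 0 := by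
      rintro rfl
      rw [hj] at hodd
      simp at hodd
    rw [hj, mul_pow]
    have : 1 ≤ j ^ 2 := by
      have := pow_pos (abs_pos.2 hj0) 2
      rw [sq_abs] at this
      omega
    nlinarith [sq_nonneg (p : ℤ)]
  have htot := hf.sum_sq_fiber p
  rw [hcard] at htot
  have hsplit : ∑ c, (∑ z with p • z = 0, f (c + z)) ^ 2 =
      ∑ c with p • c ≠ 0, (∑ z with p • z = 0, f (c + z)) ^ 2 := by
    rw [Finset.sum_filter]
    refine Finset.sum_congr rfl fun c _ => ?_
    by_cases hc : p • c = 0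
    · simp [hc, hzero c hc]
    · simp [hc]
  have hcc : (#{c : A | p • c ≠ 0} : ℤ) = Fintype.card A - p ^ 2 := by
    have := Finset.card_filter_add_card_filter_not (s := (univ : Finset A)) (fun c : A => p • c = 0)
    rw [hcard, Finset.card_univ] at this
    have h : (p ^ 2 : ℤ) + #{c : A | p • c ≠ 0} = Fintype.card A := by exact_mod_cast this
    linarith
  -- the lower bounds for the squares add up to their total, so each of them is attained
  have hall : ∑ c : A with p • c ≠ 0, (p : ℤ) ^ 2 =
      ∑ c with p • c ≠ 0, (∑ z with p • z = 0, f (c + z)) ^ 2 := by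
    rw [← hsplit, htot, sum_const, nsmul_eq_mul, hcc]
    push_cast
    ring
  rw [Finset.sum_eq_sum_iff_of_le (fun c hc => hge c (by simpa using hc))] at hall
  intro c hc
  exact (hall c (by simpa using hc)).symm

end Torsion

/-! ### Groups of rank two -/

section Rank

variable {A : Type*} [AddCommGroup A]

theorem exists_generators_of_rank_eq_two [Finite A] (h : AddGroup.rank A = 2) :
    ∃ g₁ g₂ : A, ∀ x, ∃ m n : ℤ, m • g₁ + n • g₂ = x := by
  classical
  obtain ⟨S, hS, hcl⟩ := AddGroup.rank_spec A
  rw [h, Finset.card_eq_two] at hS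
  obtain ⟨a, b, -, rfl⟩ := hS
  refine ⟨a, b, fun x => ?_⟩
  have : x ∈ AddSubgroup.closure ({a, b} : Set A) := by
    have h' : AddSubgroup.closure ({a, b} : Set A) = ⊤ := by simpa using hcl
    rw [h']
    trivial
  exact AddSubgroup.mem_closure_pair.1 this

theorem not_isAddCyclic_of_rank_eq_two [Finite A] (h : AddGroup.rank A = 2) : ¬ IsAddCyclic A := by
  rintro ⟨g, hg⟩
  have := AddGroup.rank_le (S := {g}) (show AddSubgroup.closure _ = ⊤ by
    rw [Finset.coe_singleton, ← AddSubgroup.zmultiples_eq_closure, AddSubgroup.eq_top_iff']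
    exact hg)
  rw [h] at this
  simp at this

variable [Fintype A] [DecidableEq A] {p : ℕ}

theorem card_ker_nsmul (N : ℕ) :
    Nat.card (nsmulAddMonoidHom N : A →+ A).ker = #{z : A | N • z = 0} :=
  Nat.subtype_card _ fun x => by simp [AddMonoidHom.mem_ker]

theorem exists_card_torsion_eq_pow (hp : p.Prime) : ∃ k, #{z : A | p • z = 0} = p ^ k := by
  have : Fact p.Prime := ⟨hp⟩
  let K := (nsmulAddMonoidHom p : A →+ A).ker
  have hK : ∀ x : K, p • x = 0 := fun x => Subtype.ext (by
    have := AddMonoidHom.mem_ker.1 x.2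
    rwa [nsmulAddMonoidHom_apply] at this)
  let _ : Module (ZMod p) K := AddCommGroup.zmodModule hK
  refine ⟨Module.finrank (ZMod p) K, ?_⟩
  rw [FiniteField.pow_finrank_eq_natCard, card_ker_nsmul]

theorem card_torsion_le (hp : p.Prime) {g₁ g₂ : A}
    (hg : ∀ x, ∃ m n : ℤ, m • g₁ + n • g₂ = x) : #{z : A | p • z = 0} ≤ p ^ 2 := by
  let φ := (nsmulAddMonoidHom p : A →+ A)
  have h2 : Nat.card A = #{z : A | p • z = 0} * Nat.card φ.range := by
    rw [← card_ker_nsmul, ← AddSubgroup.index_ker, AddSubgroup.card_mul_index]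
  have : Fact p.Prime := ⟨hp⟩
  have h3 : Nat.card A ≤ Nat.card (Fin p × Fin p × φ.range) := by
    refine Nat.card_le_card_of_surjective
      (fun q => (q.1 : ℕ) • g₁ + (q.2.1 : ℕ) • g₂ + q.2.2) ?_
    intro x
    obtain ⟨m, n, rfl⟩ := hg x
    have hp0 : (0 : ℤ) < p := by exact_mod_cast hp.pos
    have hlt : ∀ l : ℤ, (l % p).toNat < p := fun l => by
      have := Int.emod_lt_of_pos l hp0
      have := Int.emod_nonneg l hp0.ne'
      omega
    refine ⟨⟨⟨(m % p).toNat, hlt m⟩, ⟨(n % p).toNat, hlt n⟩,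
      ⟨p • ((m / p) • g₁ + (n / p) • g₂), ⟨_, rfl⟩⟩⟩, ?_⟩
    dsimp only
    have hm : ((m % p).toNat : ℤ) = m % p := Int.toNat_of_nonneg (Int.emod_nonneg m hp0.ne')
    have hn : ((n % p).toNat : ℤ) = n % p := Int.toNat_of_nonneg (Int.emod_nonneg n hp0.ne')
    rw [← natCast_zsmul, ← natCast_zsmul, ← natCast_zsmul, hm, hn]
    conv_rhs => rw [← Int.emod_add_mul_ediv m p, ← Int.emod_add_mul_ediv n p]
    simp only [smul_add, add_smul, mul_smul]
    abel
  rw [Nat.card_prod, Nat.card_prod, Nat.card_fin, h2, ← mul_assoc, ← pow_two] at h3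
  exact Nat.le_of_mul_le_mul_right h3 Nat.card_pos

/-- For a group generated by two elements with a Paley function, a prime `p ≥ 5` that divides the
order is its only prime divisor. Multipliers that are `1` modulo `q` fix an element `x` of order `q`,
so they show that `f` is constant on the punctured lines of both `A[p]` and `x + A[p]`. -/
theorem IsPaleyFun.eq_of_prime_dvd_card {f : A → ℤ} (hf : IsPaleyFun f)
    (hp : p.Prime) (hp5 : 5 ≤ p) (hd : p ∣ Fintype.card A) {g₁ g₂ : A}
    (hg : ∀ x, ∃ m n : ℤ, m • g₁ + n • g₂ = x) {q : ℕ} (hq : q.Prime)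
    (hqd : q ∣ Fintype.card A) : q = p := by
  by_contra hqp
  have : Fact p.Prime := ⟨hp⟩
  have : Fact q.Prime := ⟨hq⟩
  have hop : Odd p := hp.odd_of_ne_two (by omega)
  obtain ⟨x, hx⟩ := exists_prime_addOrderOf_dvd_card q hqd
  have hx0 : x ≠ 0 := by
    rintro rfl
    rw [addOrderOf_zero] at hx
    exact hq.one_lt.ne hx
  have hpx : p • x ≠ 0 := by
    intro h
    have := addOrderOf_dvd_of_nsmul_eq_zero h
    rw [hx] at this
    exact hqp ((Nat.prime_dvd_prime_iff_eq hq hp).1 this)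
  have hinv : ∀ z, p • z = 0 → ∀ s : ℕ, s.Coprime p →
      f (s • z) = f z ∧ f (x + s • z) = f (x + z) := by
    intro z hz s hs
    obtain ⟨k, m, hpm, hν⟩ := Nat.exists_eq_pow_mul_and_not_dvd (Fintype.card_ne_zero (α := A)) p
      hp.ne_one
    have hqm : q ∣ m := by
      rw [hν, hq.dvd_mul] at hqd
      rcases hqd with h | h
      · exact absurd ((Nat.prime_dvd_prime_iff_eq hq hp).1 (hq.dvd_of_dvd_pow h)) hqp
      · exact h
    have hcop : p.Coprime (2 * m) := by
      rw [hp.coprime_iff_not_dvd, hp.dvd_mul]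
      rintro (h | h)
      · have := Nat.le_of_dvd two_pos h
        omega
      · exact hpm h
    -- `t` acts as `s` on the `p`-torsion and fixes `x`; the factor `2` makes it odd
    obtain ⟨t, ht1, ht2⟩ := Nat.chineseRemainder hcop s 1
    have htodd : Odd t := by
      rw [Nat.odd_iff]
      exact (ht2.of_mul_right m : t ≡ 1 [MOD 2])
    have htm : t ≡ 1 [MOD m] := ht2.of_mul_left 2
    have htc : t.Coprime (Fintype.card A) := by
      rw [hν]
      refine Nat.Coprime.mul_right (Nat.Coprime.pow_right _ ?_) ?_
      · exact (Nat.ModEq.gcd_eq ht1).trans hs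
      · exact (Nat.ModEq.gcd_eq htm).trans (by simp)
    have htx : t • x = x := by
      have : t ≡ 1 [MOD q] := htm.of_dvd hqm
      rw [← hx] at this
      simpa using (nsmul_eq_nsmul_iff_modEq.2 this)
    have htz : t • z = s • z := by
      rw [nsmul_eq_nsmul_iff_modEq]
      exact ht1.of_dvd (addOrderOf_dvd_of_nsmul_eq_zero hz)
    have h := hf.map_nsmul htodd htc hx0 htx
    constructor
    · rw [← htz, h]
    · have := h (x + z)
      rwa [smul_add, htx, htz] at this
  have hxz : ∀ z, p • z = 0 → x + z ≠ 0 := by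
    intro z hz h
    have := congrArg (p • ·) h
    simp [smul_add, hz] at this
    exact hpx this
  obtain ⟨k, hk⟩ := exists_card_torsion_eq_pow (A := A) hp
  have hk2 : k ≤ 2 := by
    have := card_torsion_le hp hg
    rw [hk] at this
    exact (Nat.pow_le_pow_iff_right hp.one_lt).1 this
  have hk0 : k ≠ 0 := by
    rintro rfl
    obtain ⟨y, hy⟩ := exists_prime_addOrderOf_dvd_card p hd
    rw [pow_zero, Finset.card_eq_one] at hk
    obtain ⟨a, ha⟩ := hk
    have h1 : (0 : A) ∈ ({z : A | p • z = 0} : Finset A) := by simp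
    have h2 : y ∈ ({z : A | p • z = 0} : Finset A) := by
      simp [← hy, addOrderOf_nsmul_eq_zero]
    rw [ha, mem_singleton] at h1 h2
    rw [h2, ← h1, addOrderOf_zero] at hy
    exact hp.one_lt.ne hy
  have hp' : ((p - 1 : ℕ) : ℤ) = p - 1 := by rw [Nat.cast_sub hp.one_le]; simp
  have hp5' : (5 : ℤ) ≤ p := by exact_mod_cast hp5
  obtain rfl | rfl : k = 1 ∨ k = 2 := by omega
  · obtain ⟨j, hj, h⟩ := sum_torsion hp (g := f) (m := 1) (fun z _ => hf.sign z)
      (fun z hz _ s hs => (hinv z hz s hs).1) (by rw [hk, pow_one]; have := hp.pos; omega)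
    have hdv := hf.dvd_sum_fiber hp hop hd 0
    simp only [zero_add] at hdv
    rw [h, hf.map_zero, zero_add] at hdv
    have hcop : IsCoprime (p : ℤ) (p - 1) := ⟨1, -1, by ring⟩
    have := Int.natAbs_dvd_natAbs.2 (hcop.dvd_of_dvd_mul_left hdv)
    have := Nat.le_of_dvd (by omega) this
    omega
  · have h1 := (hf.fiber hp hop hk (fun z hz s hs => (hinv z hz s hs).1)).2 x hpx
    obtain ⟨j, hj, h⟩ := sum_torsion hp (g := fun z => f (x + z)) (m := p + 1)
      (fun z hz _ => hf.sign _ (hxz z hz))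
      (fun z hz _ s hs => (hinv z hz s hs).2) (by
        rw [hk]
        obtain ⟨r, rfl⟩ : ∃ r, p = r + 1 := ⟨p - 1, by omega⟩
        simp; ring)
    rw [h] at h1
    push_cast at h1
    have h2 := sq_eq_sq_iff_eq_or_eq_neg.1 h1
    simp only [add_zero] at h2
    obtain ⟨r, rfl⟩ := hop
    obtain ⟨R, hR⟩ : ∃ R : ℤ, R = j - (r + 1) := ⟨_, rfl⟩
    -- `R` is half of the even number in `± 1 + (p - 1) * (2 R) = ± p`
    have h3 : ((2 * r + 1 : ℕ) - 1 : ℤ) * (2 * j - ((2 * r + 1 : ℕ) + 1)) = 4 * (r * R) := by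
      rw [hR]; push_cast; ring
    push_cast at h3 h2 hp5'
    rw [h3] at h2
    have hs := hf.sign x hx0
    rcases lt_trichotomy R 0 with hR0 | hR0 | hR0
    · have : (r : ℤ) * R ≤ -r := by nlinarith
      omega
    · subst hR0
      omega
    · have : (r : ℤ) ≤ r * R := by nlinarith
      omega

end Rank

section PGroup

variable {A : Type*} [AddCommGroup A] [Fintype A] [DecidableEq A] {p : ℕ}

/-- If `N A` has order `p`, with `p ∣ N`, then the multipliers `1 + 2 c N` show that `f` is invariant
under translation by `N A` outside the kernel `U` of multiplication by `N`. This bounds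
`ν = ∑ f(x) (f(x) - f(x + w))` by `2 |U| ≤ 2 ν / 3`. -/
theorem IsPaleyFun.false_of_range_le_zmultiples {f : A → ℤ} (hf : IsPaleyFun f)
    (hp : p.Prime) (ho : Odd p) {k : ℕ} (hk : Fintype.card A = p ^ k) {N : ℕ} (hpN : p ∣ N)
    {w : A} (hpw : p • w = 0) (hw : w ≠ 0) (hN : ∀ x : A, N • x ∈ AddSubgroup.zmultiples w)
    {y : A} (hy : N • y ≠ 0) : False := by
  have : Fact p.Prime := ⟨hp⟩
  have how : addOrderOf w = p := addOrderOf_eq_prime hpw hw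
  have hinv : ∀ x, N • x ≠ 0 → f (x + w) = f x := by
    intro x hx
    obtain ⟨j, hj⟩ := AddSubgroup.mem_zmultiples_iff.1 (hN x)
    have hjp : ¬ (p : ℤ) ∣ j := by
      intro h
      apply hx
      rw [← hj, ← addOrderOf_dvd_iff_zsmul_eq_zero, how]
      exact h
    have hp2 : ¬ (p : ℤ) ∣ 2 := by
      intro h
      have := Int.le_of_dvd two_pos h
      have := hp.two_le
      obtain ⟨r, hr⟩ := ho
      omega
    have hunit : ((2 * j : ℤ) : ZMod p) ≠ 0 := by
      rw [Ne, ZMod.intCast_zmod_eq_zero_iff_dvd, (Nat.prime_iff_prime_int.1 hp).dvd_mul]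
      tauto
    -- `c` inverts `2 j` modulo `p`, so that `(2 c N) • x = (2 c j) • w = w`
    let c := (((2 * j : ℤ) : ZMod p)⁻¹).val
    have hc : (p : ℤ) ∣ c * (2 * j) - 1 := by
      rw [← ZMod.intCast_zmod_eq_zero_iff_dvd]
      push_cast
      simp only [c, ZMod.natCast_val, ZMod.cast_id', id_eq]
      push_cast at hunit ⊢
      rw [inv_mul_cancel₀ hunit, sub_self]
    have hcw : (2 * c * N) • x = w := by
      rw [mul_smul, ← hj, ← natCast_zsmul, ← mul_smul]
      have h1 : ((2 * c : ℕ) : ℤ) * j = (c * (2 * j) - 1) + 1 := by push_cast; ring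
      rw [h1, add_smul, one_smul, addOrderOf_dvd_iff_zsmul_eq_zero.1 (how ▸ hc), zero_add]
    have h := hf.map_nsmul (t := 2 * c * N + 1) ⟨c * N, by ring⟩ (by
      rw [hk]
      refine Nat.Coprime.pow_right _ ?_
      rw [Nat.coprime_comm, hp.coprime_iff_not_dvd, (Nat.dvd_add_right (hpN.mul_left _))]
      exact hp.one_lt.not_ge ∘ Nat.le_of_dvd one_pos) hw (by
      obtain ⟨M, rfl⟩ := hpN
      rw [add_smul, one_smul, mul_comm p M, ← mul_assoc, mul_smul, hpw, smul_zero, zero_add]) x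
    rw [add_smul, one_smul, hcw, add_comm] at h
    exact h
  have hsum : ∑ x, f x * (f x - f (x + w)) = Fintype.card A := by
    simp only [mul_sub, sum_sub_distrib, hf.corr w]
    have := hf.corr 0
    simp only [add_zero] at this
    rw [this]
    simp [hw]
  have hle : ∑ x, f x * (f x - f (x + w)) ≤ ∑ x : A, if N • x = 0 then 2 else 0 := by
    refine Finset.sum_le_sum fun x _ => ?_
    split_ifs with hx
    · rcases hf.sign_or_zero x with h | h | h <;> rcases hf.sign_or_zero (x + w) with h' | h' | h' <;>
        rw [h, h'] <;> norm_num
    · rw [hinv x hx]; simp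
  let φ := (nsmulAddMonoidHom N : A →+ A)
  have hker : #{x : A | N • x = 0} = Nat.card φ.ker := (card_ker_nsmul N).symm
  rw [hsum, ← Finset.sum_filter, sum_const, hker] at hle
  obtain ⟨c, hc⟩ := AddSubgroup.card_addSubgroup_dvd_card φ.ker
  rw [Nat.card_eq_fintype_card] at hc
  have hco : Odd c := by
    have : Odd (Fintype.card A) := hk ▸ ho.pow
    rw [hc, Nat.odd_mul] at this
    exact this.2
  have hc1 : c ≠ 1 := by
    rintro rfl
    rw [mul_one, ← Nat.card_eq_fintype_card] at hc
    have := AddSubgroup.eq_top_of_card_eq _ hc.symm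
    exact hy (by
      have h : y ∈ φ.ker := this ▸ AddSubgroup.mem_top y
      simpa [φ] using h)
  have hpos : 0 < Nat.card φ.ker := Nat.card_pos
  have hc3 : 3 ≤ c := by
    obtain ⟨r, rfl⟩ := hco
    omega
  rw [hc] at hle
  push_cast at hle
  have h4 : (Nat.card φ.ker : ℤ) * 3 ≤ Nat.card φ.ker * c := by
    have : (3 : ℤ) ≤ c := by exact_mod_cast hc3
    gcongr
  rw [nsmul_eq_mul] at hle
  have h5 : (0 : ℤ) < Nat.card φ.ker := by exact_mod_cast hpos
  linarith

omit [Fintype A] [DecidableEq A] in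
/-- A relation between the generators `N • g₁` and `N • g₂` of the elementary abelian group `N A`, with
a coefficient prime to `p`, makes `N A` cyclic. -/
theorem range_le_zmultiples_of_relation {N : ℕ} (hp : p.Prime) {g₁ g₂ : A}
    (hg : ∀ x, ∃ m n : ℤ, m • g₁ + n • g₂ = x) (hN : ∀ x : A, p • N • x = 0) {i j : ℤ}
    (hi : ¬ (p : ℤ) ∣ i) (hij : N • (i • g₁ + j • g₂) = 0) (x : A) :
    N • x ∈ AddSubgroup.zmultiples (N • g₂) := by
  have hcop : IsCoprime (p : ℤ) i :=
    ((Nat.prime_iff_prime_int.1 hp).coprime_iff_not_dvd).2 hi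
  obtain ⟨a, b, hab⟩ := hcop
  have h1 : N • g₁ = (-(b * j)) • N • g₂ := by
    have h2 : N • g₁ = (a * p + b * i) • N • g₁ := by rw [hab, one_smul]
    have h3 : i • N • g₁ = - (j • N • g₂) := by
      rw [eq_neg_iff_add_eq_zero, ← hij, smul_add, smul_comm i, smul_comm j]
    rw [h2, add_smul, mul_smul, natCast_zsmul, hN, smul_zero, zero_add, mul_smul, h3, smul_neg,
      neg_smul, mul_smul]
  obtain ⟨m, n, rfl⟩ := hg x
  rw [smul_add, smul_comm N m, smul_comm N n, h1]
  exact add_mem (zsmul_mem (zsmul_mem (AddSubgroup.mem_zmultiples _) _) _)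
    (zsmul_mem (AddSubgroup.mem_zmultiples _) _)

/-- A noncyclic two-generated `p`-group with a Paley function is homocyclic: the natural map
`ℤ_{p^n} ⊕ ℤ_{p^n} → A`, with `p ^ n` the exponent, cannot have a nontrivial kernel. -/
theorem IsPaleyFun.nonempty_addEquiv {f : A → ℤ} (hf : IsPaleyFun f)
    (hp : p.Prime) (ho : Odd p) {k : ℕ} (hk : Fintype.card A = p ^ k) {g₁ g₂ : A}
    (hg : ∀ x, ∃ m n : ℤ, m • g₁ + n • g₂ = x) (hcyc : ¬ IsAddCyclic A) :
    ∃ n, 0 < n ∧ Nonempty (A ≃+ Grp p n) := by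
  have : Fact p.Prime := ⟨hp⟩
  have hexp : AddMonoid.exponent A ∣ p ^ k := by
    rw [← hk, ← Nat.card_eq_fintype_card]
    exact AddGroup.exponent_dvd_nat_card
  obtain ⟨n, -, hn⟩ := (Nat.dvd_prime_pow hp).1 hexp
  have hn0 : n ≠ 0 := by
    rintro rfl
    rw [pow_zero, AddMonoid.exp_eq_one_iff] at hn
    exact hcyc inferInstance
  have hkill : ∀ x : A, p ^ n • x = 0 := fun x => hn ▸ AddMonoid.exponent_nsmul_eq_zero x
  have hp0 : p ^ n ≠ 0 := pow_ne_zero _ hp.ne_zero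
  let φ₁ : ZMod (p ^ n) →+ A := ZMod.lift (p ^ n) ⟨zmultiplesHom A g₁, by
    rw [zmultiplesHom_apply, natCast_zsmul]
    exact hkill g₁⟩
  let φ₂ : ZMod (p ^ n) →+ A := ZMod.lift (p ^ n) ⟨zmultiplesHom A g₂, by
    rw [zmultiplesHom_apply, natCast_zsmul]
    exact hkill g₂⟩
  let φ : Grp p n →+ A := φ₁.coprod φ₂
  have hφ : ∀ i j : ℤ, φ ((i : ZMod (p ^ n)), (j : ZMod (p ^ n))) = i • g₁ + j • g₂ := by
    intro i j
    simp [φ, φ₁, φ₂]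
  have hsurj : Function.Surjective φ := by
    intro x
    obtain ⟨m, l, rfl⟩ := hg x
    exact ⟨_, hφ m l⟩
  refine ⟨n, Nat.pos_of_ne_zero hn0, ?_⟩
  by_cases hinj : Function.Injective φ
  · exact ⟨(AddEquiv.ofBijective φ ⟨hinj, hsurj⟩).symm⟩
  exfalso
  obtain ⟨N, rfl⟩ : ∃ N, n = N + 1 := ⟨n - 1, by omega⟩
  have hN : ∀ x : A, p • p ^ N • x = 0 := by
    intro x
    rw [← mul_smul, ← pow_succ']
    exact hkill x
  obtain ⟨y, hy⟩ : ∃ y : A, p ^ N • y ≠ 0 := by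
    by_contra! h
    have := AddMonoid.exponent_dvd_of_forall_nsmul_eq_zero h
    rw [hn, Nat.pow_dvd_pow_iff_le_right hp.one_lt] at this
    omega
  -- an element of order `p` in the kernel is `p ^ N` times a pair that is nonzero modulo `p`
  obtain ⟨i, j, hij, hrel⟩ : ∃ i j : ℤ, (¬ (p : ℤ) ∣ i ∨ ¬ (p : ℤ) ∣ j) ∧
      p ^ N • (i • g₁ + j • g₂) = 0 := by
    have : φ.ker ≠ ⊥ := fun h => hinj ((AddMonoidHom.ker_eq_bot_iff φ).1 h)
    have hd : p ∣ Nat.card φ.ker := by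
      obtain ⟨l, -, hl⟩ := (Nat.dvd_prime_pow hp (m := (N + 1) + (N + 1))).1
        (show Nat.card φ.ker ∣ _ from (AddSubgroup.card_addSubgroup_dvd_card φ.ker).trans
          (by rw [Nat.card_prod, Nat.card_zmod, ← pow_add]))
      rw [hl]
      refine dvd_pow_self p ?_
      rintro rfl
      rw [pow_zero, AddSubgroup.card_eq_one] at hl
      exact this hl
    obtain ⟨⟨⟨u, v⟩, hz⟩, hzo⟩ := exists_prime_addOrderOf_dvd_card' p hd
    rw [AddSubgroup.addOrderOf_mk] at hzo
    obtain ⟨i, rfl⟩ := ZMod.intCast_surjective u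
    obtain ⟨j, rfl⟩ := ZMod.intCast_surjective v
    have h1 : p • ((i : ZMod (p ^ (N + 1))), (j : ZMod (p ^ (N + 1)))) = 0 := by
      have := addOrderOf_nsmul_eq_zero ((i : ZMod (p ^ (N + 1))), (j : ZMod (p ^ (N + 1))))
      rwa [hzo] at this
    have h2 : ∀ i : ℤ, p • (i : ZMod (p ^ (N + 1))) = 0 → ((p : ℤ) ^ N) ∣ i := by
      intro i h
      have h3 : ((p * i : ℤ) : ZMod (p ^ (N + 1))) = 0 := by
        push_cast; rw [← h, nsmul_eq_mul]
      rw [ZMod.intCast_zmod_eq_zero_iff_dvd] at h3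
      push_cast at h3
      rw [pow_succ', mul_dvd_mul_iff_left (by exact_mod_cast hp.ne_zero)] at h3
      exact h3
    rw [Prod.smul_mk, Prod.mk_eq_zero] at h1
    obtain ⟨i, rfl⟩ := h2 _ h1.1
    obtain ⟨j, rfl⟩ := h2 _ h1.2
    refine ⟨i, j, ?_, ?_⟩
    · by_contra! hcon
      obtain ⟨⟨i, rfl⟩, ⟨j, rfl⟩⟩ := hcon
      have h4 : ∀ i : ℤ, ((p ^ N * (p * i) : ℤ) : ZMod (p ^ (N + 1))) = 0 := by
        intro i
        rw [ZMod.intCast_zmod_eq_zero_iff_dvd]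
        exact ⟨i, by push_cast; ring⟩
      rw [h4, h4] at hzo
      have : addOrderOf (0 : Grp p (N + 1)) = p := hzo
      rw [addOrderOf_zero] at this
      exact hp.one_lt.ne this
    · have := AddMonoidHom.mem_ker.1 hz
      rw [hφ] at this
      rw [← this, smul_add, mul_smul, mul_smul, ← natCast_zsmul, ← natCast_zsmul]
      push_cast
      rfl
  obtain ⟨w, hw⟩ : ∃ w : A, ∀ x, p ^ N • x ∈ AddSubgroup.zmultiples (p ^ N • w) := by
    rcases hij with h | h
    · exact ⟨g₂, range_le_zmultiples_of_relation hp hg hN h hrel⟩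
    · refine ⟨g₁, range_le_zmultiples_of_relation hp (g₁ := g₂) (g₂ := g₁) ?_ hN h
        (by rw [add_comm]; exact hrel)⟩
      intro x
      obtain ⟨a, b, h⟩ := hg x
      exact ⟨b, a, by rw [add_comm]; exact h⟩
  by_cases hN0 : N = 0
  · subst hN0
    exact hcyc ⟨w, fun x => AddSubgroup.mem_zmultiples_iff.1
      (by simpa only [pow_zero, one_smul] using hw x)⟩
  · refine hf.false_of_range_le_zmultiples hp ho hk (dvd_pow_self p hN0) (hN w) ?_ hw hy
    intro h
    have := hw y
    rw [h] at this
    simp at this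
    exact hy this

end PGroup

/-! ### Symplectic Fourier analysis on `ℤ_{p^n} ⊕ ℤ_{p^n}` -/

section Fourier

variable {p n : ℕ} [Fact p.Prime]

theorem card_torsion_zmod (hn : 0 < n) : #{v : ZMod (p ^ n) | (p : ZMod (p ^ n)) * v = 0} = p := by
  obtain ⟨N, rfl⟩ : ∃ N, n = N + 1 := ⟨n - 1, by omega⟩
  have hp : p.Prime := Fact.out
  have hpN : 0 < p ^ N := pow_pos hp.pos _
  conv_rhs => rw [← Finset.card_range p]
  symm
  refine Finset.card_bij (fun k _ => ((p ^ N * k : ℕ) : ZMod (p ^ (N + 1)))) ?_ ?_ ?_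
  · intro k _
    simp only [mem_filter, mem_univ, true_and]
    rw [← Nat.cast_mul, ZMod.natCast_eq_zero_iff, pow_succ', ← mul_assoc]
    exact dvd_mul_right _ _
  · intro k hk l hl h
    rw [mem_range] at hk hl
    rw [ZMod.natCast_eq_natCast_iff, pow_succ] at h
    have := Nat.ModEq.mul_left_cancel' hpN.ne' h
    rwa [Nat.ModEq, Nat.mod_eq_of_lt hk, Nat.mod_eq_of_lt hl] at this
  · intro v hv
    simp only [mem_filter, mem_univ, true_and] at hv
    obtain ⟨m, rfl⟩ := ZMod.natCast_zmod_surjective v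
    rw [← Nat.cast_mul, ZMod.natCast_eq_zero_iff, pow_succ',
      Nat.mul_dvd_mul_iff_left hp.pos] at hv
    obtain ⟨k, rfl⟩ := hv
    refine ⟨k % p, by simpa using Nat.mod_lt _ hp.pos, ?_⟩
    rw [ZMod.natCast_eq_natCast_iff, pow_succ]
    exact Nat.ModEq.mul_left' _ (Nat.mod_modEq k p)

omit [Fact p.Prime] in
theorem not_isUnit_iff (hp : p.Prime) (hn : 0 < n) {u : ZMod (p ^ n)} :
    ¬ IsUnit u ↔ ∃ v, (p : ZMod (p ^ n)) * v = u := by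
  have : NeZero (p ^ n) := ⟨pow_ne_zero _ hp.ne_zero⟩
  obtain ⟨m, rfl⟩ := ZMod.natCast_zmod_surjective u
  rw [ZMod.isUnit_iff_coprime, Nat.coprime_pow_right_iff hn, Nat.coprime_comm,
    hp.coprime_iff_not_dvd, not_not]
  constructor
  · rintro ⟨k, rfl⟩
    exact ⟨k, by simp⟩
  · rintro ⟨v, hv⟩
    obtain ⟨k, rfl⟩ := ZMod.natCast_zmod_surjective v
    rw [← Nat.cast_mul, ZMod.natCast_eq_natCast_iff] at hv
    have h1 := hv.of_dvd (dvd_pow_self p hn.ne')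
    exact (Nat.modEq_zero_iff_dvd).1 (h1.symm.trans ((Nat.modEq_zero_iff_dvd).2 (dvd_mul_right _ _)))

open Classical in
theorem card_fiber_zmod (hn : 0 < n) (u : ZMod (p ^ n)) :
    #{v : ZMod (p ^ n) | (p : ZMod (p ^ n)) * v = u} = if IsUnit u then 0 else p := by
  split_ifs with hu
  · rw [Finset.card_eq_zero, Finset.filter_eq_empty_iff]
    intro v _ hv
    exact (not_isUnit_iff Fact.out hn).2 ⟨v, hv⟩ hu
  · obtain ⟨v₀, rfl⟩ := (not_isUnit_iff Fact.out hn).1 hu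
    refine Eq.trans ?_ (card_torsion_zmod (p := p) hn)
    refine Finset.card_bij (fun v _ => v - v₀) ?_ (by simp) ?_
    · intro v hv
      simp only [mem_filter, mem_univ, true_and] at hv ⊢
      rw [mul_sub, hv, sub_self]
    · intro v hv
      simp only [mem_filter, mem_univ, true_and] at hv
      exact ⟨v + v₀, by simp [mul_add, hv], by simp⟩

open Classical in
/-- Splitting a sum over `ℤ_{p^n}` into units and multiples of `p`; each multiple of `p` is hit `p`
times by `v ↦ p v`. -/
theorem sum_isUnit (hn : 0 < n) {M : Type*} [CommRing M] (h : ZMod (p ^ n) → M) :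
    p * ∑ u with IsUnit u, h u + ∑ v, h (p * v) = p * ∑ u, h u := by
  have h1 : ∑ v, h (p * v) = ∑ u, if IsUnit u then 0 else p * h u := by
    rw [← Finset.sum_fiberwise (univ : Finset (ZMod (p ^ n))) (fun v => (p : ZMod (p ^ n)) * v)]
    refine Finset.sum_congr rfl fun u _ => ?_
    rw [Finset.sum_congr rfl (g := fun _ => h u) (fun v hv => by
      simp only [mem_filter, mem_univ, true_and] at hv
      rw [hv]), sum_const, card_fiber_zmod hn]
    split_ifs <;> simp
  rw [h1, Finset.sum_filter, mul_sum, mul_sum, ← sum_add_distrib]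
  refine Finset.sum_congr rfl fun u _ => ?_
  split_ifs <;> simp

/-- The standard symplectic form on `ℤ_{p^n} ⊕ ℤ_{p^n}`. -/
def pairing (a x : Grp p n) : ZMod (p ^ n) := a.1 * x.2 - a.2 * x.1

/-- The Fourier transform of `f`, where the symplectic form identifies `ℤ_{p^n} ⊕ ℤ_{p^n}` with its
character group. -/
noncomputable def sympFourier (f : Grp p n → ℤ) (a : Grp p n) : ℂ :=
  ∑ x, (f x : ℂ) * ZMod.stdAddChar (pairing a x)

theorem sum_stdAddChar (t : ZMod (p ^ n)) :
    ∑ u : ZMod (p ^ n), (ZMod.stdAddChar (u * t) : ℂ) = if t = 0 then (p : ℂ) ^ n else 0 := by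
  rw [AddChar.sum_mulShift t (ZMod.isPrimitive_stdAddChar _), ZMod.card]
  push_cast
  rfl

theorem sum_stdAddChar_pairing (x : Grp p n) :
    ∑ a, (ZMod.stdAddChar (pairing a x) : ℂ) = if x = 0 then (p : ℂ) ^ (2 * n) else 0 := by
  have h : ∀ a : Grp p n, (ZMod.stdAddChar (pairing a x) : ℂ) =
      ZMod.stdAddChar (a.1 * x.2) * ZMod.stdAddChar (a.2 * (-x.1)) := by
    intro a
    rw [← AddChar.map_add_eq_mul, pairing]
    congr 1
    ring
  simp only [h]
  rw [Fintype.sum_prod_type]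
  simp only [← mul_sum, ← sum_mul, sum_stdAddChar, neg_eq_zero]
  obtain ⟨x1, x2⟩ := x
  by_cases h1 : x1 = 0 <;> by_cases h2 : x2 = 0 <;> simp [h1, h2, two_mul, pow_add]

omit [Fact p.Prime] in
theorem pairing_swap (a x : Grp p n) : pairing a x = pairing x (-a) := by
  simp [pairing]; ring

theorem sum_stdAddChar_pairing_right (a : Grp p n) :
    ∑ x, (ZMod.stdAddChar (pairing a x) : ℂ) = if a = 0 then (p : ℂ) ^ (2 * n) else 0 := by
  simp only [pairing_swap a, sum_stdAddChar_pairing, neg_eq_zero]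

/-- `f` is invariant under multiplication by the units of `ℤ_{p^n}`, that is, `f x` depends only on the
cyclic subgroup generated by `x`. -/
def UnitInvariant (f : Grp p n → ℤ) : Prop :=
  ∀ u : ZMod (p ^ n), IsUnit u → ∀ x, f (u • x) = f x

open Classical in
theorem card_isUnit (hn : 0 < n) : (p : ℤ) * #{u : ZMod (p ^ n) | IsUnit u} = (p - 1) * p ^ n := by
  have := sum_isUnit (p := p) hn (fun _ : ZMod (p ^ n) => (1 : ℤ))
  simp only [sum_const, card_univ, ZMod.card, nsmul_eq_mul, mul_one] at this
  push_cast at this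
  linarith

/-- Averaging over the units replaces the character values by Ramanujan sums. -/
theorem UnitInvariant.sub_one_mul_sympFourier {f : Grp p n → ℤ} (hf : UnitInvariant f)
    (hn : 0 < n) (a : Grp p n) :
    ((p : ℂ) - 1) * sympFourier f a =
      ∑ x, (f x : ℂ) * ((if pairing a x = 0 then (p : ℂ) else 0) -
        (if p * pairing a x = 0 then 1 else 0)) := by
  classical
  have hp : p.Prime := Fact.out
  have hpn : (p : ℂ) ^ n ≠ 0 := pow_ne_zero _ (by exact_mod_cast hp.ne_zero)
  have h1 : ∀ u : ZMod (p ^ n), IsUnit u →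
      ∑ x, (f x : ℂ) * ZMod.stdAddChar (u * pairing a x) = sympFourier f a := by
    intro u hu
    have hb : Function.Bijective (fun x : Grp p n => u • x) := by
      obtain ⟨w, rfl⟩ := hu
      exact MulAction.bijective w
    refine Fintype.sum_bijective _ hb _ _ fun x => ?_
    rw [hf u hu]
    congr 2
    simp only [pairing, Prod.smul_fst, Prod.smul_snd, smul_eq_mul]
    ring
  have h2 : (#{u : ZMod (p ^ n) | IsUnit u} : ℂ) * sympFourier f a =
      ∑ x, (f x : ℂ) * ∑ u with IsUnit u, (ZMod.stdAddChar (u * pairing a x) : ℂ) := by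
    simp only [mul_sum]
    rw [Finset.sum_comm, Finset.sum_congr rfl (g := fun _ => sympFourier f a)
      (fun u hu => h1 u (by simpa using hu)), sum_const, nsmul_eq_mul]
  have h3 : ∀ t : ZMod (p ^ n), (p : ℂ) * ∑ u with IsUnit u, (ZMod.stdAddChar (u * t) : ℂ) =
      p ^ n * ((if t = 0 then (p : ℂ) else 0) - (if p * t = 0 then 1 else 0)) := by
    intro t
    have := sum_isUnit hn (fun u : ZMod (p ^ n) => (ZMod.stdAddChar (u * t) : ℂ))
    rw [sum_stdAddChar] at this
    have h4 : ∀ v : ZMod (p ^ n), p * v * t = v * (p * t) := fun v => by ring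
    simp only [h4, sum_stdAddChar] at this
    rw [eq_sub_of_add_eq this]
    split_ifs <;> ring
  have h5 := congrArg ((p : ℂ) * ·) h2
  simp only [mul_sum (a := (p : ℂ))] at h5
  have h6 : (p : ℂ) * #{u : ZMod (p ^ n) | IsUnit u} = (p - 1) * p ^ n := by
    exact_mod_cast card_isUnit (p := p) hn
  have h7 : ∀ x, (p : ℂ) * ((f x : ℂ) * ∑ u with IsUnit u, (ZMod.stdAddChar (u * pairing a x) : ℂ)) =
      p ^ n * ((f x : ℂ) * ((if pairing a x = 0 then (p : ℂ) else 0) -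
        (if p * pairing a x = 0 then 1 else 0))) := by
    intro x
    rw [mul_left_comm, h3]
    ring
  rw [← mul_assoc, h6, Finset.sum_congr rfl (fun x _ => h7 x), ← mul_sum] at h5
  refine mul_left_cancel₀ hpn ?_
  rw [← h5]
  ring

/-- The sum of `g` over the multiples `u • b` of `b`, with `u` ranging over `ℤ_{p^n}`. Each element
of `⟨b⟩` is thus counted `p ^ n / |⟨b⟩|` times. -/
def ray (g : Grp p n → ℤ) (b : Grp p n) : ℤ := ∑ u : ZMod (p ^ n), g (u • b)

theorem ray_eq (hn : 0 < n) {g : Grp p n → ℤ} {b : Grp p n}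
    (hg : ∀ u : ZMod (p ^ n), IsUnit u → g (u • b) = g b) :
    p * ray g b = (p - 1) * p ^ n * g b + ray g (p • b) := by
  classical
  have h := sum_isUnit hn (fun u : ZMod (p ^ n) => g (u • b))
  rw [Finset.sum_congr rfl (g := fun _ => g b) (fun u hu => hg u (by simpa using hu)),
    sum_const, nsmul_eq_mul, ← mul_assoc, card_isUnit hn] at h
  rw [ray, ← h, ray]
  congr 1
  refine Finset.sum_congr rfl fun u _ => ?_
  rw [smul_comm, ← Nat.cast_smul_eq_nsmul (ZMod (p ^ n)), mul_smul]

/-- Summation in the coordinates with respect to a symplectic basis `a, b`. -/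
theorem sum_eq_sum_basis {M : Type*} [AddCommMonoid M] {a b : Grp p n} (hab : pairing a b = 1)
    (F : Grp p n → M) :
    ∑ x, F x = ∑ u : ZMod (p ^ n), ∑ s : ZMod (p ^ n), F (u • a + s • b) := by
  rw [← Fintype.sum_prod_type' (f := fun u s => F (u • a + s • b))]
  symm
  unfold pairing at hab
  refine Fintype.sum_equiv
    { toFun := fun us => us.1 • a + us.2 • b
      invFun := fun x => (pairing x b, pairing a x)
      left_inv := ?_
      right_inv := ?_ } _ _ (fun _ => rfl)
  · rintro ⟨u, s⟩
    simp only [pairing, Prod.fst_add, Prod.snd_add, Prod.smul_fst, Prod.smul_snd, smul_eq_mul]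
    ext
    · dsimp only
      linear_combination u * hab
    · dsimp only
      linear_combination s * hab
  · rintro ⟨x, y⟩
    ext
    · simp only [pairing, Prod.fst_add, Prod.smul_fst, smul_eq_mul]
      linear_combination x * hab
    · simp only [pairing, Prod.snd_add, Prod.smul_snd, smul_eq_mul]
      linear_combination y * hab

omit [Fact p.Prime] in
theorem pairing_basis {a b : Grp p n} (hab : pairing a b = 1) (u s : ZMod (p ^ n)) :
    pairing a (u • a + s • b) = s := by
  unfold pairing at hab ⊢
  simp only [Prod.fst_add, Prod.snd_add, Prod.smul_fst, Prod.smul_snd, smul_eq_mul]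
  linear_combination s * hab

omit [Fact p.Prime] in
theorem nsmul_basis_eq_zero_iff {a b : Grp p n} (hab : pairing a b = 1) (u s : ZMod (p ^ n)) :
    p • (u • a + s • b) = 0 ↔ p * u = 0 ∧ p * s = 0 := by
  constructor
  · intro h
    unfold pairing at hab
    rw [← Nat.cast_smul_eq_nsmul (ZMod (p ^ n)), Prod.ext_iff] at h
    simp only [Prod.fst_add, Prod.snd_add, Prod.smul_fst, Prod.smul_snd, smul_eq_mul,
      Prod.fst_zero, Prod.snd_zero] at h
    constructor
    · linear_combination b.2 * h.1 - b.1 * h.2 - p * u * hab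
    · linear_combination a.1 * h.2 - a.2 * h.1 - p * s * hab
  · rintro ⟨h1, h2⟩
    rw [← Nat.cast_smul_eq_nsmul (ZMod (p ^ n)), smul_add, ← mul_smul, ← mul_smul, h1, h2]
    simp

theorem sum_torsion_basis {M : Type*} [AddCommMonoid M] {a b : Grp p n} (hab : pairing a b = 1)
    (F : Grp p n → M) :
    ∑ z with p • z = 0, F z = ∑ u : ZMod (p ^ n) with (p : ZMod (p ^ n)) * u = 0,
      ∑ s : ZMod (p ^ n) with (p : ZMod (p ^ n)) * s = 0, F (u • a + s • b) := by
  rw [Finset.sum_filter, sum_eq_sum_basis hab, Finset.sum_filter]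
  refine Finset.sum_congr rfl fun u _ => ?_
  rw [Finset.sum_filter]
  simp only [nsmul_basis_eq_zero_iff hab]
  by_cases hu : (p : ZMod (p ^ n)) * u = 0 <;> simp only [hu, true_and, false_and, if_true,
    if_false, sum_const_zero]

theorem card_torsion_grp (hn : 0 < n) : #{z : Grp p n | p • z = 0} = p ^ 2 := by
  have h := sum_torsion_basis (p := p) (n := n) (a := (1, 0)) (b := (0, 1)) (by simp [pairing])
    (fun _ => (1 : ℕ))
  simpa [card_torsion_zmod hn, pow_two] using h

/-- The Fourier coefficients at elements `a` of order `p ^ n`; the existence of `b` with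
`pairing a b = 1` expresses that condition on `a`. -/
theorem UnitInvariant.sub_one_mul_sympFourier_of_primitive {f h : Grp p n → ℤ}
    (hf : UnitInvariant f) (hn : 0 < n)
    (hh : ∀ c, ∑ z with p • z = 0, f (c + z) = p * h (p • c)) {a b : Grp p n}
    (hab : pairing a b = 1) :
    ((p : ℂ) - 1) * sympFourier f a =
      (((p - 1) * p ^ n * f a + (ray f (p • a) - ray h (p • a)) : ℤ) : ℂ) := by
  have hp : p.Prime := Fact.out
  have h1 : ∑ x, f x * (if pairing a x = 0 then (p : ℤ) else 0) = p * ray f a := by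
    rw [sum_eq_sum_basis hab, ray, mul_sum]
    refine Finset.sum_congr rfl fun u _ => ?_
    simp [pairing_basis hab, mul_comm]
  have h2 : ∑ x, f x * (if p * pairing a x = 0 then (1 : ℤ) else 0) = ray h (p • a) := by
    have hp0 : (p : ℤ) ≠ 0 := by exact_mod_cast hp.ne_zero
    refine mul_left_cancel₀ hp0 ?_
    have h3 : p * ray h (p • a) = ∑ v : ZMod (p ^ n), ∑ z with p • z = 0, f (v • a + z) := by
      rw [ray, mul_sum]
      refine Finset.sum_congr rfl fun v _ => ?_
      rw [hh, smul_comm]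
    rw [h3]
    simp only [sum_torsion_basis hab]
    rw [Finset.sum_comm]
    have h4 : ∀ r : ZMod (p ^ n),
        ∑ v : ZMod (p ^ n), ∑ s : ZMod (p ^ n) with (p : ZMod (p ^ n)) * s = 0,
          f (v • a + (r • a + s • b)) =
        ∑ v : ZMod (p ^ n), ∑ s : ZMod (p ^ n) with (p : ZMod (p ^ n)) * s = 0,
          f (v • a + s • b) := by
      intro r
      refine Fintype.sum_equiv (Equiv.addRight r) _ _ fun v => ?_
      refine Finset.sum_congr rfl fun s _ => ?_
      rw [Equiv.coe_addRight, add_smul, add_assoc]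
    simp only [h4, sum_const, card_torsion_zmod hn, nsmul_eq_mul]
    congr 1
    rw [sum_eq_sum_basis hab]
    refine Finset.sum_congr rfl fun u _ => ?_
    rw [Finset.sum_filter]
    simp [pairing_basis hab]
  have h5 := ray_eq (b := a) hn (fun u hu => hf u hu a)
  rw [hf.sub_one_mul_sympFourier hn]
  have h6 : ∑ x, f x * ((if pairing a x = 0 then (p : ℤ) else 0) -
        (if p * pairing a x = 0 then 1 else 0)) =
      (p - 1) * p ^ n * f a + (ray f (p • a) - ray h (p • a)) := by
    simp only [mul_sub, sum_sub_distrib]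
    rw [h1, h2, h5]
    ring
  rw [← h6]
  push_cast
  rfl

theorem pow_nsmul_eq_zero_iff {a b : Grp p n} (hab : pairing a b = 1) (i : ℕ) :
    p ^ i • a = 0 ↔ n ≤ i := by
  have hp : p.Prime := Fact.out
  rw [← Nat.pow_dvd_pow_iff_le_right hp.one_lt, ← ZMod.natCast_eq_zero_iff]
  constructor
  · intro h
    have h1 : pairing (p ^ i • a) b = (p ^ i : ℕ) * pairing a b := by simp [pairing]; ring
    rw [h, hab, mul_one] at h1
    rw [← h1]
    simp [pairing]
  · intro h
    rw [← Nat.cast_smul_eq_nsmul (ZMod (p ^ n)), h, zero_smul]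

theorem exists_eq_pow_smul_primitive (hn : 0 < n) (c : Grp p n) :
    ∃ k ≤ n, ∃ a b : Grp p n, pairing a b = 1 ∧ c = p ^ k • a := by
  have hp : p.Prime := Fact.out
  have key : ∀ m ≤ n, ∀ c : Grp p n,
      (∃ k ≤ n, ∃ a b : Grp p n, pairing a b = 1 ∧ c = p ^ k • a) ∨
      ∃ d, c = p ^ m • d := by
    intro m
    induction m with
    | zero => exact fun _ c => Or.inr ⟨c, by simp⟩
    | succ m ih =>
      intro hm c
      rcases ih (by omega) c with h | ⟨d, rfl⟩
      · exact Or.inl h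
      by_cases h1 : IsUnit d.1
      · obtain ⟨w, hw⟩ := h1
        refine Or.inl ⟨m, by omega, d, (0, (w⁻¹ : (ZMod (p ^ n))ˣ)), ?_, rfl⟩
        simp [pairing, ← hw]
      by_cases h2 : IsUnit d.2
      · obtain ⟨w, hw⟩ := h2
        refine Or.inl ⟨m, by omega, d, (-(w⁻¹ : (ZMod (p ^ n))ˣ), 0), ?_, rfl⟩
        simp [pairing, ← hw]
      · obtain ⟨v1, hv1⟩ := (not_isUnit_iff hp hn).1 h1
        obtain ⟨v2, hv2⟩ := (not_isUnit_iff hp hn).1 h2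
        refine Or.inr ⟨(v1, v2), ?_⟩
        rw [pow_succ, mul_smul]
        congr 1
        ext <;> simp [← hv1, ← hv2]
  rcases key n le_rfl c with h | ⟨d, rfl⟩
  · exact h
  · refine ⟨n, le_rfl, (1, 0), (0, 1), by simp [pairing], ?_⟩
    have : ∀ e : Grp p n, p ^ n • e = 0 := by
      intro e
      rw [← Nat.cast_smul_eq_nsmul (ZMod (p ^ n)), ZMod.natCast_self, zero_smul]
    rw [this, this]

end Fourier

/-! ### Paley functions on `ℤ_{p^n} ⊕ ℤ_{p^n}` are the self-similar ones -/

section Grp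

variable {p n : ℕ} [Fact p.Prime]

theorem card_grp : Fintype.card (Grp p n) = p ^ (2 * n) := by
  rw [Fintype.card_prod, ZMod.card, two_mul, pow_add]

theorem IsPaleyFun.unitInvariant {f : Grp p n → ℤ} (hf : IsPaleyFun f) (ho : Odd p) :
    UnitInvariant f := by
  intro u hu x
  have hcard : Fintype.card (Grp p n) = p ^ (2 * n) := card_grp
  have hsq : IsSquare (Fintype.card (Grp p n)) := ⟨p ^ n, by rw [hcard, two_mul, pow_add]⟩
  have hop : Odd (p ^ n) := ho.pow
  obtain ⟨m, rfl⟩ := ZMod.natCast_zmod_surjective u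
  obtain ⟨t, hto, htu⟩ : ∃ t : ℕ, Odd t ∧ (t : ZMod (p ^ n)) = m := by
    rcases Nat.even_or_odd m with h | h
    · exact ⟨m + p ^ n, h.add_odd hop, by rw [Nat.cast_add, ZMod.natCast_self, add_zero]⟩
    · exact ⟨m, h, rfl⟩
  rw [← htu] at hu ⊢
  rw [ZMod.isUnit_iff_coprime] at hu
  have htc : t.Coprime (Fintype.card (Grp p n)) := by
    rw [hcard, mul_comm, pow_mul]
    exact hu.pow_right _
  rw [Nat.cast_smul_eq_nsmul]
  exact hf.map_nsmul_of_isSquare hsq hto htc x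

omit [Fact p.Prime] in
theorem UnitInvariant.map_nsmul {f : Grp p n → ℤ} (hf : UnitInvariant f) {s : ℕ}
    (hs : s.Coprime p) (x : Grp p n) : f (s • x) = f x := by
  rw [← Nat.cast_smul_eq_nsmul (ZMod (p ^ n))]
  exact hf _ ((ZMod.isUnit_iff_coprime _ _).2 (hs.pow_right _)) x

theorem IsPaleyFun.sympFourier_sq {f : Grp p n → ℤ} (hf : IsPaleyFun f) {a : Grp p n} (ha : a ≠ 0) :
    sympFourier f a ^ 2 = (p : ℂ) ^ (2 * n) := by
  have h1 : ∀ x z : Grp p n, (ZMod.stdAddChar (pairing a x) * ZMod.stdAddChar (pairing a (z - x)) : ℂ)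
      = ZMod.stdAddChar (pairing a z) := by
    intro x z
    rw [← AddChar.map_add_eq_mul]
    congr 1
    simp [pairing]; ring
  have h2 : sympFourier f a ^ 2 =
      ∑ z, ((∑ x, f x * f (z - x) : ℤ) : ℂ) * ZMod.stdAddChar (pairing a z) := by
    rw [pow_two, sympFourier, Finset.sum_mul_sum]
    push_cast
    simp only [sum_mul]
    rw [Finset.sum_comm (s := univ) (t := univ)
      (f := fun z x => (f x : ℂ) * f (z - x) * ZMod.stdAddChar (pairing a z))]
    refine Finset.sum_congr rfl fun x _ => ?_
    refine Fintype.sum_equiv (Equiv.addLeft x) _ _ fun y => ?_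
    rw [Equiv.coe_addLeft, ← h1 x (x + y), add_sub_cancel_left]
    ring
  rw [h2]
  simp only [hf.conv]
  push_cast
  simp only [sub_mul, sum_sub_distrib, one_mul, ite_mul, zero_mul, Finset.sum_ite_eq',
    mem_univ, if_true, sum_stdAddChar_pairing_right, if_neg ha, sub_zero]
  have : pairing a 0 = 0 := by simp [pairing]
  rw [this, AddChar.map_zero_eq_one, card_grp, mul_one]
  push_cast
  rfl

/-- A Paley function on `ℤ_{p^n} ⊕ ℤ_{p^n}` is self-similar: its sum over the fibre of multiplication by
`p` above `p c` is `p f(p c)`. -/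
theorem IsPaleyFun.sum_fiber {f : Grp p n → ℤ} (hf : IsPaleyFun f) (ho : Odd p) (hn : 0 < n)
    (c : Grp p n) : ∑ z with p • z = 0, f (c + z) = p * f (p • c) := by
  have hp : p.Prime := Fact.out
  have hp0 : (0 : ℤ) < p := by exact_mod_cast hp.pos
  have hinv := hf.unitInvariant ho
  obtain ⟨h0, hsq⟩ := hf.fiber hp ho (card_torsion_grp hn) (fun z _ s hs => hinv.map_nsmul hs z)
  let h : Grp p n → ℤ := fun y => (∑ x with p • x = y, f x) / p
  have hfib : ∀ c, (h (p • c) = 0 ∧ p • c = 0) ∨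
      (p • c ≠ 0 ∧ (h (p • c) = 1 ∨ h (p • c) = -1)) := by
    intro c
    by_cases hc : p • c = 0
    · refine Or.inl ⟨?_, hc⟩
      simp only [h]
      rw [hc, h0, Int.zero_ediv]
    · refine Or.inr ⟨hc, ?_⟩
      simp only [h, sum_fiber_eq]
      rcases sq_eq_sq_iff_eq_or_eq_neg.1 (hsq c hc) with h | h <;> rw [h]
      · exact Or.inl (Int.ediv_self hp0.ne')
      · right
        rw [Int.neg_ediv_of_dvd dvd_rfl, Int.ediv_self hp0.ne']
  have hh : ∀ c, ∑ z with p • z = 0, f (c + z) = p * h (p • c) := by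
    intro c
    simp only [h, sum_fiber_eq]
    refine (Int.mul_ediv_cancel' ?_).symm
    by_cases hc : p • c = 0
    · rw [← sum_fiber_eq, hc, h0]
      exact dvd_zero _
    · rcases sq_eq_sq_iff_eq_or_eq_neg.1 (hsq c hc) with h | h <;> rw [h]
      exact (dvd_refl _).neg_right
  -- `D` is the defect of self-similarity; only its values on `p G` matter
  let D : Grp p n → ℤ := fun y => f y - h y
  have hD : ∀ c, D (p • c) = 0 ∨ D (p • c) = 2 ∨ D (p • c) = -2 := by
    intro c
    rcases hfib c with ⟨h1, h2⟩ | ⟨h1, h2⟩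
    · left
      simp only [D]
      rw [h1, h2, hf.map_zero, sub_zero]
    · have := hf.sign _ h1
      simp only [D]
      omega
  have hD0 : D 0 = 0 := by
    have := hfib 0
    rw [smul_zero] at this
    simp only [D, hf.map_zero]
    simpa using this
  have hray_sub : ∀ b, ray D b = ray f b - ray h b := fun b => by
    simp [ray, D, sum_sub_distrib]
  have hDray : ∀ c, |ray D (p • c)| < 2 * p ^ n := by
    intro c
    refine (Finset.abs_sum_le_sum_abs _ _).trans_lt ?_
    have h1 : ∀ u : ZMod (p ^ n), |D (u • p • c)| ≤ if u = 0 then 0 else 2 := by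
      intro u
      split_ifs with hu
      · simp [hu, hD0]
      · rw [smul_comm]
        rcases hD (u • c) with h | h | h <;> rw [h] <;> norm_num
    refine (Finset.sum_le_sum fun u _ => h1 u).trans_lt ?_
    have h2 : ∑ u : ZMod (p ^ n), (if u = 0 then (0 : ℤ) else 2) = 2 * p ^ n - 2 := by
      have h3 : ∀ u : ZMod (p ^ n), (if u = 0 then (0 : ℤ) else 2) = 2 - if u = 0 then 2 else 0 := by
        intro u; split_ifs <;> simp
      simp only [h3, sum_sub_distrib]
      simp [ZMod.card]
      ring
    rw [h2]
    omega
  have hp3 : (3 : ℤ) ≤ p := by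
    have := hp.two_le
    obtain ⟨r, hr⟩ := ho
    omega
  have hpn : (0 : ℤ) < p ^ n := pow_pos hp0 _
  -- `f̂(a) = ± p ^ n`: the wrong sign would make the ray sum too large
  have hfirst : ∀ a b : Grp p n, pairing a b = 1 → ray D (p • a) = 0 := by
    intro a b hab
    have ha : a ≠ 0 := by
      rintro rfl
      have h1 : (0 : ZMod (p ^ n)) = 1 := by simpa [pairing] using hab
      have : Fact (1 < p ^ n) := ⟨Nat.one_lt_pow hn.ne' hp.one_lt⟩
      exact zero_ne_one h1
    have hF := hinv.sub_one_mul_sympFourier_of_primitive hn hh hab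
    rw [← hray_sub] at hF
    have hb := hDray a
    rw [abs_lt] at hb
    have hF2 : sympFourier f a = ((p ^ n : ℤ) : ℂ) ∨ sympFourier f a = ((-p ^ n : ℤ) : ℂ) := by
      have := hf.sympFourier_sq ha
      rw [mul_comm 2 n, pow_mul] at this
      push_cast
      exact sq_eq_sq_iff_eq_or_eq_neg.1 this
    have hint : ((p : ℤ) - 1) * p ^ n = (p - 1) * p ^ n * f a + ray D (p • a) ∨
        -(((p : ℤ) - 1) * p ^ n) = (p - 1) * p ^ n * f a + ray D (p • a) := by
      rcases hF2 with h | h <;> rw [h] at hF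
      · left; exact_mod_cast hF
      · right
        have : ((p : ℤ) - 1) * (-p ^ n) = (p - 1) * p ^ n * f a + ray D (p • a) := by
          exact_mod_cast hF
        linarith
    have hbig : 2 * (p : ℤ) ^ n ≤ (p - 1) * p ^ n := by nlinarith
    rcases hf.sign a ha with h | h <;> rw [h] at hint <;> rcases hint with h' | h' <;> linarith
  -- the recursion for ray sums removes one value of `D` at a time
  have hstep : ∀ c : Grp p n, ray D (p • c) = 0 → D (p • c) = 0 ∧ ray D (p • p • c) = 0 := by
    intro c hc
    have h1 := ray_eq (g := D) (b := p • c) hn (fun u hu => by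
      have h2 : h (u • p • c) = h (p • c) := by
        refine mul_left_cancel₀ hp0.ne' ?_
        rw [smul_comm, ← hh, ← hh]
        have hb : Function.Bijective (fun x : Grp p n => u • x) := by
          obtain ⟨w, rfl⟩ := hu
          exact MulAction.bijective w
        symm
        refine Finset.sum_bijective _ hb ?_ ?_
        · intro z
          simp only [mem_filter, mem_univ, true_and]
          rw [smul_comm]
          exact ⟨fun h => by rw [h, smul_zero], fun h => hb.1 (by simpa using h)⟩
        · intro z _
          rw [← smul_add, hinv u hu]
      simp only [D, h2, hinv u hu])
    rw [hc, mul_zero] at h1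
    have hb := hDray (p • c)
    rw [abs_lt] at hb
    have hbig : 2 * (p : ℤ) ^ n ≤ (p - 1) * p ^ n := by nlinarith
    have hDc : D (p • c) = 0 := by
      rcases hD c with h | h | h
      · exact h
      · rw [h] at h1; linarith
      · rw [h] at h1; linarith
    exact ⟨hDc, by rw [hDc] at h1; linarith⟩
  obtain ⟨k, -, a, b, hab, rfl⟩ := exists_eq_pow_smul_primitive hn c
  have hall : ∀ k : ℕ, ray D (p • p ^ k • a) = 0 := by
    intro k
    induction k with
    | zero => simpa using hfirst a b hab
    | succ k ih =>
      rw [pow_succ', mul_smul]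
      exact (hstep _ ih).2
  rw [hh]
  congr 1
  have := (hstep _ (hall k)).1
  simp only [D] at this
  omega

/-- A self-similar function is an eigenfunction of the symplectic Fourier transform. The transform
inherits the self-similarity of `f` (`hrec` below), which reduces the claim to elements of order
`p ^ n`. -/
theorem UnitInvariant.sympFourier_eq {f : Grp p n → ℤ} (hf : UnitInvariant f) (hn : 0 < n)
    (h0 : f 0 = 0) (hh : ∀ c, ∑ z with p • z = 0, f (c + z) = p * f (p • c)) (a : Grp p n) :
    sympFourier f a = p ^ n * f a := by
  have hp : p.Prime := Fact.out
  have hp0 : (p : ℂ) ≠ 0 := by exact_mod_cast hp.ne_zero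
  have hp1 : (p : ℂ) - 1 ≠ 0 := by
    rw [sub_ne_zero]
    exact_mod_cast hp.one_lt.ne'
  have hpr : ∀ a b : Grp p n, pairing a b = 1 → sympFourier f a = p ^ n * f a := by
    intro a b hab
    have := hf.sub_one_mul_sympFourier_of_primitive hn hh hab
    rw [sub_self, add_zero] at this
    refine mul_left_cancel₀ hp1 ?_
    rw [this]
    push_cast
    ring
  -- both sides count solutions of `p w = x`, the left one by orthogonality of characters
  have hcount : ∀ x : Grp p n, ∑ z with p • z = 0, (ZMod.stdAddChar (pairing z x) : ℂ) =
      #{w : Grp p n | p • w = x} := by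
    intro x
    have hpp : (p : ℂ) ^ (2 * n) ≠ 0 := pow_ne_zero _ hp0
    have h1 : ∀ w y : Grp p n, pairing y (p • w - x) = pairing (p • y) w + pairing y (-x) := by
      intro w y
      simp [pairing]; ring
    have h2 : ∑ w : Grp p n, ∑ y : Grp p n, (ZMod.stdAddChar (pairing y (p • w - x)) : ℂ) =
        p ^ (2 * n) * #{w : Grp p n | p • w = x} := by
      simp only [sum_stdAddChar_pairing, sub_eq_zero]
      rw [← Finset.sum_filter, sum_const, nsmul_eq_mul, mul_comm]
    rw [Finset.sum_comm] at h2
    simp only [h1, AddChar.map_add_eq_mul, ← sum_mul, sum_stdAddChar_pairing_right] at h2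
    refine mul_left_cancel₀ hpp ?_
    rw [← h2, mul_sum, Finset.sum_filter]
    have h3 : ∀ y : Grp p n, pairing y (-x) = pairing (-y) x := fun y => by simp [pairing]
    refine Fintype.sum_equiv (Equiv.neg _) _ _ fun y => ?_
    simp [h3]
  have hrec : ∀ c : Grp p n, ∑ z with p • z = 0, sympFourier f (c + z) =
      p * sympFourier f (p • c) := by
    intro c
    have h1 : ∀ z x : Grp p n, pairing (c + z) x = pairing c x + pairing z x := fun z x => by
      simp [pairing]; ring
    have h2 : ∑ z with p • z = 0, sympFourier f (c + z) =
        ∑ w, (f (p • w) : ℂ) * ZMod.stdAddChar (pairing c (p • w)) := by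
      simp only [sympFourier, h1, AddChar.map_add_eq_mul, ← mul_assoc]
      rw [Finset.sum_comm]
      simp only [← mul_sum, hcount]
      rw [← Finset.sum_fiberwise (univ : Finset (Grp p n)) (fun w => p • w)
        (fun w => (f (p • w) : ℂ) * ZMod.stdAddChar (pairing c (p • w)))]
      refine Finset.sum_congr rfl fun x _ => ?_
      rw [Finset.sum_congr rfl (g := fun _ => (f x : ℂ) * ZMod.stdAddChar (pairing c x))
        (fun w hw => by
          simp only [mem_filter, mem_univ, true_and] at hw
          rw [hw]), sum_const, nsmul_eq_mul]
      ring
    have h3 : ∀ w, (p : ℂ) * f (p • w) = ∑ z with p • z = 0, (f (w + z) : ℂ) := by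
      intro w
      exact_mod_cast (hh w).symm
    refine mul_left_cancel₀ hp0 ?_
    rw [h2, mul_sum]
    simp only [← mul_assoc, h3, sum_mul]
    rw [Finset.sum_comm]
    have h4 : ∀ z ∈ ({z : Grp p n | p • z = 0} : Finset (Grp p n)),
        ∑ w, (f (w + z) : ℂ) * ZMod.stdAddChar (pairing c (p • w)) =
        sympFourier f (p • c) := by
      intro z hz
      simp only [mem_filter, mem_univ, true_and] at hz
      refine Fintype.sum_equiv (Equiv.addRight z) _ _ fun w => ?_
      have : pairing (p • c) (w + z) = pairing c (p • w) + pairing c (p • z) := by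
        simp [pairing]; ring
      rw [Equiv.coe_addRight, this, hz]
      simp [pairing]
    rw [Finset.sum_congr rfl h4, sum_const, card_torsion_grp hn, nsmul_eq_mul]
    push_cast
    ring
  have hmain : ∀ k < n, ∀ a b : Grp p n, pairing a b = 1 →
      sympFourier f (p ^ k • a) = p ^ n * f (p ^ k • a) := by
    intro k
    induction k with
    | zero => intro _ a b hab; simpa using hpr a b hab
    | succ k ih =>
      intro hk a b hab
      refine mul_left_cancel₀ hp0 ?_
      rw [pow_succ', mul_smul, ← hrec]
      have h1 : ∀ z ∈ ({z : Grp p n | p • z = 0} : Finset (Grp p n)),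
          sympFourier f (p ^ k • a + z) = p ^ n * f (p ^ k • a + z) := by
        intro z hz
        simp only [mem_filter, mem_univ, true_and] at hz
        obtain ⟨j, -, a', b', hab', hc⟩ := exists_eq_pow_smul_primitive hn (p ^ k • a + z)
        -- both sides become `p ^ (k + 1) • a` after multiplication by `p`, which forces `j = k`
        have hord : ∀ i, n ≤ i + (j + 1) ↔ n ≤ i + (k + 1) := by
          intro i
          have h1 : p ^ (i + (j + 1)) • a' = p ^ i • p • p ^ j • a' := by
            rw [pow_add, pow_succ', mul_smul, mul_smul]
          have h2 : p ^ (i + (k + 1)) • a = p ^ i • p • p ^ k • a := by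
            rw [pow_add, pow_succ', mul_smul, mul_smul]
          rw [← pow_nsmul_eq_zero_iff hab', ← pow_nsmul_eq_zero_iff hab, h1, h2, ← hc,
            smul_add p, hz, add_zero]
        have h1 := hord (n - k - 1)
        have h2 := hord (n - k - 2)
        obtain rfl : j = k := by omega
        rw [hc]
        exact ih (by omega) a' b' hab'
      rw [Finset.sum_congr rfl h1, ← mul_sum]
      have := congrArg (Int.cast : ℤ → ℂ) (hh (p ^ k • a))
      push_cast at this
      rw [this]
      ring
  have hne : ∀ c : Grp p n, c ≠ 0 → sympFourier f c = p ^ n * f c := by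
    intro c hc
    obtain ⟨k, hk, a, b, hab, rfl⟩ := exists_eq_pow_smul_primitive hn c
    refine hmain k (lt_of_le_of_ne hk ?_) a b hab
    rintro rfl
    apply hc
    rw [← Nat.cast_smul_eq_nsmul (ZMod (p ^ k)), ZMod.natCast_self, zero_smul]
  by_cases ha : a = 0
  · subst ha
    have h1 := hrec 0
    have h2 := hh 0
    simp only [zero_add, smul_zero, h0, mul_zero] at h1 h2
    have hins : ({z : Grp p n | p • z = 0} : Finset (Grp p n)) =
        insert 0 ({z : Grp p n | p • z = 0 ∧ z ≠ 0} : Finset (Grp p n)) := by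
      ext z
      by_cases hz : z = 0 <;> simp [hz]
    rw [hins, Finset.sum_insert (by simp)] at h1 h2
    rw [Finset.sum_congr rfl (g := fun z => (p : ℂ) ^ n * f z) (fun z hz => hne z (by
      simp only [mem_filter, mem_univ, true_and] at hz
      exact hz.2)), ← mul_sum] at h1
    rw [h0, zero_add] at h2
    have h3 : ∑ z : Grp p n with p • z = 0 ∧ z ≠ 0, (f z : ℂ) = 0 := by exact_mod_cast h2
    rw [h3, mul_zero, add_zero] at h1
    have h4 : ((p : ℂ) - 1) * sympFourier f 0 = 0 := by rw [sub_mul, ← h1]; ring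
    rw [h0, (mul_eq_zero.1 h4).resolve_left hp1]
    simp
  · exact hne a ha

/-- Self-similarity implies the Paley property, by Fourier inversion of `f̂ ^ 2 = p ^ (2 n) f ^ 2`. -/
theorem UnitInvariant.isPaleyFun {f : Grp p n → ℤ} (hf : UnitInvariant f) (hn : 0 < n)
    (h0 : f 0 = 0) (hsign : ∀ x, x ≠ 0 → f x = 1 ∨ f x = -1)
    (hh : ∀ c, ∑ z with p • z = 0, f (c + z) = p * f (p • c)) : IsPaleyFun f := by
  have hp : p.Prime := Fact.out
  have hp0 : (p : ℂ) ≠ 0 := by exact_mod_cast hp.ne_zero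
  have hF := hf.sympFourier_eq hn h0 hh
  have hneg : ∀ x, f (-x) = f x := fun x => by
    have := hf (-1) (by simp) x
    simpa using this
  refine ⟨h0, hsign, hneg, ?_, ?_⟩
  · have := hF 0
    simp only [sympFourier, h0] at this
    have h1 : ∀ x : Grp p n, pairing 0 x = 0 := fun x => by simp [pairing]
    simp only [h1, AddChar.map_zero_eq_one, mul_one, Int.cast_zero, mul_zero] at this
    exact_mod_cast this
  · intro z
    have hpp : (p : ℂ) ^ (2 * n) ≠ 0 := pow_ne_zero _ hp0
    have hsq : ∀ a, (f a : ℂ) * f a = 1 - if a = 0 then 1 else 0 := by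
      intro a
      by_cases ha : a = 0
      · simp [ha, h0]
      · rcases hsign a ha with h | h <;> simp [ha, h]
    have h1 : ∑ a, sympFourier f a * sympFourier f a *
        ZMod.stdAddChar (pairing a z) =
        (p : ℂ) ^ (2 * n) * ((if z = 0 then (p : ℂ) ^ (2 * n) else 0) - 1) := by
      have : ∀ a, sympFourier f a * sympFourier f a *
          ZMod.stdAddChar (pairing a z) = (p : ℂ) ^ (2 * n) * (ZMod.stdAddChar (pairing a z) -
            if a = 0 then (ZMod.stdAddChar (pairing a z) : ℂ) else 0) := by
        intro a
        rw [hF]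
        have h2 : (p : ℂ) ^ n * f a * (p ^ n * f a) = p ^ (2 * n) * (f a * f a) := by
          rw [two_mul, pow_add]; ring
        rw [h2, hsq]
        split_ifs <;> ring
      simp only [this]
      rw [← mul_sum, sum_sub_distrib, sum_stdAddChar_pairing, Finset.sum_ite_eq' univ 0]
      simp [pairing]
    have h2 : ∑ a, sympFourier f a * sympFourier f a *
        ZMod.stdAddChar (pairing a z) = (p : ℂ) ^ (2 * n) * ∑ x, (f x : ℂ) * f (x + z) := by
      have h3 : ∀ a, sympFourier f a * sympFourier f a *
          ZMod.stdAddChar (pairing a z) =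
          ∑ x, ∑ y, (f x : ℂ) * f y * ZMod.stdAddChar (pairing a (x + y + z)) := by
        intro a
        rw [sympFourier, Finset.sum_mul_sum, sum_mul]
        refine Finset.sum_congr rfl fun x _ => ?_
        rw [sum_mul]
        refine Finset.sum_congr rfl fun y _ => ?_
        have : pairing a (x + y + z) = pairing a x + pairing a y + pairing a z := by
          simp [pairing]; ring
        rw [this, AddChar.map_add_eq_mul, AddChar.map_add_eq_mul]
        ring
      simp only [h3]
      rw [Finset.sum_comm, mul_sum]
      refine Finset.sum_congr rfl fun x _ => ?_
      rw [Finset.sum_comm]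
      simp only [← mul_sum, sum_stdAddChar_pairing]
      rw [Finset.sum_eq_single_of_mem (-(x + z)) (mem_univ _)]
      · rw [if_pos (by abel), hneg]
        ring
      · intro y _ hy
        rw [if_neg, mul_zero]
        intro h
        apply hy
        rw [eq_neg_iff_add_eq_zero, ← h]
        abel
    rw [h1] at h2
    have h4 := mul_left_cancel₀ hpp h2
    rw [card_grp]
    have h5 : (((if z = 0 then ((p ^ (2 * n) : ℕ) : ℤ) else 0) - 1 : ℤ) : ℂ) =
        (if z = 0 then (p : ℂ) ^ (2 * n) else 0) - 1 := by
      split_ifs <;> simp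
    rw [← h5] at h4
    exact_mod_cast h4.symm

end Grp

/-! ### Homogeneous sets and fibre sums -/

section Sons

variable {p n : ℕ} [Fact p.Prime]

omit [Fact p.Prime] in
theorem zmultiples_unit_smul {u : ZMod (p ^ n)} (hu : IsUnit u) (x : Grp p n) :
    AddSubgroup.zmultiples (u • x) = AddSubgroup.zmultiples x := by
  have key : ∀ (v : ZMod (p ^ n)) (x : Grp p n),
      AddSubgroup.zmultiples (v • x) ≤ AddSubgroup.zmultiples x := by
    intro v x
    rw [AddSubgroup.zmultiples_le]
    obtain ⟨k, rfl⟩ := ZMod.intCast_surjective v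
    rw [Int.cast_smul_eq_zsmul]
    exact zsmul_mem (AddSubgroup.mem_zmultiples x) k
  refine le_antisymm (key u x) ?_
  obtain ⟨w, rfl⟩ := hu
  have := key (w⁻¹ : (ZMod (p ^ n))ˣ) ((w : ZMod (p ^ n)) • x)
  rwa [← mul_smul, Units.inv_mul, one_smul] at this

theorem isUnit_intCast_iff (hn : 0 < n) (k : ℤ) : IsUnit (k : ZMod (p ^ n)) ↔ ¬ (p : ℤ) ∣ k := by
  rw [← not_iff_not, not_not, not_isUnit_iff Fact.out hn]
  constructor
  · rintro ⟨v, hv⟩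
    obtain ⟨l, rfl⟩ := ZMod.intCast_surjective v
    have h1 : ((p * l - k : ℤ) : ZMod (p ^ n)) = 0 := by push_cast; rw [hv, sub_self]
    rw [ZMod.intCast_zmod_eq_zero_iff_dvd] at h1
    push_cast at h1
    have h2 := (dvd_pow_self (p : ℤ) hn.ne').trans h1
    exact (dvd_sub_right (dvd_mul_right _ _)).1 h2
  · rintro ⟨l, rfl⟩
    exact ⟨l, by push_cast; rfl⟩

theorem exists_unit_smul_of_zmultiples_eq (hn : 0 < n) {x y : Grp p n}
    (h : AddSubgroup.zmultiples x = AddSubgroup.zmultiples y) :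
    ∃ u : ZMod (p ^ n), IsUnit u ∧ y = u • x := by
  obtain ⟨k, hk⟩ := AddSubgroup.mem_zmultiples_iff.1 (h ▸ AddSubgroup.mem_zmultiples y)
  obtain ⟨l, hl⟩ := AddSubgroup.mem_zmultiples_iff.1 (h ▸ AddSubgroup.mem_zmultiples x)
  by_cases hpk : (p : ℤ) ∣ k
  · -- then `x = l k x` with `1 - l k` a unit, so that `x = y = 0`
    have h1 : IsUnit ((1 - l * k : ℤ) : ZMod (p ^ n)) := by
      rw [isUnit_intCast_iff hn]
      intro h2
      have h3 : (p : ℤ) ∣ 1 := by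
        have := dvd_add h2 (hpk.mul_left l)
        simpa using this
      have := (Fact.out : p.Prime).one_lt
      have := Int.le_of_dvd one_pos h3
      omega
    have h2 : ((1 - l * k : ℤ) : ZMod (p ^ n)) • x = 0 := by
      rw [Int.cast_smul_eq_zsmul, sub_smul, one_smul, mul_smul, hk, hl, sub_self]
    have hx : x = 0 := h1.smul_eq_zero.1 h2
    refine ⟨1, isUnit_one, ?_⟩
    rw [one_smul, ← hk, hx, smul_zero]
  · exact ⟨k, (isUnit_intCast_iff hn k).2 hpk, by rw [Int.cast_smul_eq_zsmul, hk]⟩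

omit [Fact p.Prime] in
theorem father_zmultiples (x : Grp p n) :
    father (AddSubgroup.zmultiples x) = AddSubgroup.zmultiples (p • x) := by
  rw [father, AddMonoidHom.map_zmultiples, nsmulAddMonoidHom_apply]

omit [Fact p.Prime] in
theorem mem_Delta_iff {H : AddSubgroup (Grp p n)} :
    H ∈ Delta p n ↔ ∃ x, AddSubgroup.zmultiples x = H := by
  rw [Delta, Set.mem_ofPred_eq, AddSubgroup.isAddCyclic_iff_exists_zmultiples_eq_top]

omit [Fact p.Prime] in
theorem pow_nsmul_grp (x : Grp p n) : p ^ n • x = 0 := by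
  rw [← Nat.cast_smul_eq_nsmul (ZMod (p ^ n)), ZMod.natCast_self, zero_smul]

/-- The generators `x'` of `⟨x⟩` with `p x' = p x ≠ 0` form a coset of the subgroup of order `p`. -/
theorem ncard_generators_above (hn : 0 < n) {x : Grp p n} (hx : p • x ≠ 0) :
    {x' | p • x' = p • x ∧ AddSubgroup.zmultiples x' = AddSubgroup.zmultiples x}.ncard = p := by
  have hp : p.Prime := Fact.out
  have hx0 : x ≠ 0 := by
    rintro rfl
    exact hx (smul_zero _)
  obtain ⟨r, hr⟩ : p ∣ addOrderOf x := by
    obtain ⟨m, -, hm⟩ := (Nat.dvd_prime_pow hp).1 (addOrderOf_dvd_of_nsmul_eq_zero (pow_nsmul_grp x))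
    rw [hm]
    refine dvd_pow_self p ?_
    rintro rfl
    rw [pow_zero, AddMonoid.addOrderOf_eq_one_iff] at hm
    exact hx0 hm
  have hr0 : 0 < r := by
    have := addOrderOf_pos x
    rw [hr] at this
    exact Nat.pos_of_mul_pos_left this
  have hw : addOrderOf (r • x) = p := by
    refine addOrderOf_eq_prime ?_ ?_
    · rw [← mul_smul, ← hr, addOrderOf_nsmul_eq_zero]
    · intro h0
      have := Nat.le_of_dvd hr0 (addOrderOf_dvd_of_nsmul_eq_zero h0)
      rw [hr] at this
      have := hp.two_le
      nlinarith
  have himage : {x' | p • x' = p • x ∧ AddSubgroup.zmultiples x' = AddSubgroup.zmultiples x} =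
      (fun z => x + z) '' (AddSubgroup.zmultiples (r • x) : Set (Grp p n)) := by
    ext x'
    constructor
    · rintro ⟨h1, h2⟩
      obtain ⟨k, rfl⟩ := AddSubgroup.mem_zmultiples_iff.1
        (h2 ▸ AddSubgroup.mem_zmultiples x' : x' ∈ AddSubgroup.zmultiples x)
      have h3 : ((p : ℤ) * (k - 1)) • x = 0 := by
        rw [mul_smul, sub_smul, one_smul, smul_sub, natCast_zsmul, natCast_zsmul, h1, sub_self]
      rw [← addOrderOf_dvd_iff_zsmul_eq_zero, hr] at h3
      push_cast at h3
      rw [mul_dvd_mul_iff_left (by exact_mod_cast hp.ne_zero)] at h3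
      obtain ⟨t, ht⟩ := h3
      refine ⟨t • r • x, zsmul_mem (AddSubgroup.mem_zmultiples _) t, ?_⟩
      dsimp only
      rw [← natCast_zsmul, ← mul_smul, mul_comm, ← ht, sub_smul, one_smul, add_sub_cancel]
    · rintro ⟨z, hz, rfl⟩
      obtain ⟨k, rfl⟩ := AddSubgroup.mem_zmultiples_iff.1 hz
      have hpz : p • k • r • x = 0 := by
        rw [smul_comm, ← mul_smul p, ← hr, addOrderOf_nsmul_eq_zero, smul_zero]
      refine ⟨by rw [smul_add, hpz, add_zero], ?_⟩
      have h1 : x + k • r • x = ((1 + k * r : ℤ) : ZMod (p ^ n)) • x := by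
        rw [Int.cast_smul_eq_zsmul, add_smul, one_smul, mul_smul, natCast_zsmul]
      dsimp only
      rw [h1]
      refine zmultiples_unit_smul ((isUnit_intCast_iff hn _).2 fun hd => hx ?_) x
      -- otherwise `k * r` is prime to `p`, yet it annihilates `p • x`
      have hu : IsUnit ((k * r : ℤ) : ZMod (p ^ n)) := by
        rw [isUnit_intCast_iff hn]
        intro h2
        have := Int.le_of_dvd one_pos ((dvd_add_left h2).1 hd)
        have := hp.one_lt
        omega
      refine hu.smul_eq_zero.1 ?_
      rw [Int.cast_smul_eq_zsmul, mul_smul, natCast_zsmul, smul_comm r, smul_comm k, hpz]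
  rw [himage, Set.ncard_image_of_injective _ (add_right_injective x), ← Nat.card_coe_set_eq]
  exact (Nat.card_zmultiples _).trans hw

/-- A cyclic subgroup whose father is generated by `y ≠ 0` contains exactly `p` generators `x'`
with `p x' = y`. -/
theorem card_generators_above (hn : 0 < n) {x y : Grp p n} (hy : y ≠ 0)
    (h : father (AddSubgroup.zmultiples x) = AddSubgroup.zmultiples y) :
    {x' | p • x' = y ∧ AddSubgroup.zmultiples x' = AddSubgroup.zmultiples x}.ncard = p := by
  rw [father_zmultiples] at h
  obtain ⟨u, hu, rfl⟩ := exists_unit_smul_of_zmultiples_eq hn h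
  rw [smul_comm, ← zmultiples_unit_smul hu x]
  rw [smul_comm] at hy
  exact ncard_generators_above hn hy

open Classical in
/-- Each son of `⟨y⟩` in `T` contributes `p` preimages of `y`, or its `p - 1` generators if `y = 0`. -/
theorem card_fiber_generatorSet (hn : 0 < n) {T : Set (AddSubgroup (Grp p n))}
    (hbot : ⊥ ∉ T) (y : Grp p n) :
    #{x | p • x = y ∧ AddSubgroup.zmultiples x ∈ T} =
      (sons (AddSubgroup.zmultiples y) ∩ T).ncard * (if y = 0 then p - 1 else p) := by
  have hp : p.Prime := Fact.out
  rw [Set.ncard_eq_toFinset_card' ]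
  rw [Finset.card_eq_sum_card_fiberwise (f := AddSubgroup.zmultiples)
    (t := (sons (AddSubgroup.zmultiples y) ∩ T).toFinset)]
  · rw [← smul_eq_mul, ← sum_const]
    refine Finset.sum_congr rfl fun F hF => ?_
    rw [Set.mem_toFinset] at hF
    obtain ⟨⟨hFD, hFy⟩, hFT⟩ := hF
    obtain ⟨x, rfl⟩ := mem_Delta_iff.1 hFD
    have hx0 : x ≠ 0 := by
      rintro rfl
      rw [AddSubgroup.zmultiples_zero_eq_bot] at hFT
      exact hbot hFT
    split_ifs with hy
    · subst hy
      rw [father_zmultiples, AddSubgroup.zmultiples_zero_eq_bot, AddSubgroup.zmultiples_eq_bot] at hFy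
      have hxp : (addOrderOf x).totient = p - 1 := by
        rw [addOrderOf_eq_prime hFy hx0, Nat.totient_prime hp]
      rw [← hxp, ← card_generators x]
      congr 1
      ext x'
      simp only [mem_filter, mem_univ, true_and, and_iff_right_iff_imp]
      intro hx'
      refine ⟨?_, hx' ▸ hFT⟩
      rw [← AddSubgroup.zmultiples_eq_bot, ← father_zmultiples, hx', father_zmultiples, hFy,
        AddSubgroup.zmultiples_zero_eq_bot]
    · refine Eq.trans ?_ (card_generators_above hn hy hFy)
      rw [← Set.ncard_coe_finset]
      congr 1
      ext x'
      simp only [coe_filter, mem_filter, mem_univ, true_and, Set.mem_ofPred_eq]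
      constructor
      · rintro ⟨⟨h1, -⟩, h2⟩
        exact ⟨h1, h2⟩
      · rintro ⟨h1, h2⟩
        exact ⟨⟨h1, h2 ▸ hFT⟩, h2⟩
  · intro x hx
    simp only [coe_filter, mem_univ, true_and, Set.mem_ofPred_eq] at hx
    rw [Set.coe_toFinset]
    exact ⟨⟨mem_Delta_iff.2 ⟨x, rfl⟩, by rw [father_zmultiples, hx.1]⟩, hx.2⟩

omit [Fact p.Prime] in
theorem mem_generatorSet {T : Set (AddSubgroup (Grp p n))} {x : Grp p n} :
    x ∈ generatorSet T ↔ AddSubgroup.zmultiples x ∈ T := by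
  simp [generatorSet]

omit [Fact p.Prime] in
theorem signFun_generatorSet {T : Set (AddSubgroup (Grp p n))} {x : Grp p n} (hx : x ≠ 0)
    [Decidable (AddSubgroup.zmultiples x ∈ T)] :
    signFun (generatorSet T) x = if AddSubgroup.zmultiples x ∈ T then 1 else -1 := by
  rw [signFun, if_neg hx]
  simp only [mem_generatorSet]

/-- Fibre sums of the sign function in terms of the number of sons in `T`. -/
theorem sum_fiber_signFun (hn : 0 < n) {T : Set (AddSubgroup (Grp p n))}
    (hbot : ⊥ ∉ T) (c : Grp p n) :
    ∑ z with p • z = 0, signFun (generatorSet T) (c + z) =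
      if p • c = 0 then
        ((p : ℤ) - 1) * (2 * (sons (AddSubgroup.zmultiples (p • c)) ∩ T).ncard - (p + 1))
      else p * (2 * (sons (AddSubgroup.zmultiples (p • c)) ∩ T).ncard - p) := by
  classical
  have hp : p.Prime := Fact.out
  have hp1 : ((p - 1 : ℕ) : ℤ) = p - 1 := by rw [Nat.cast_sub hp.one_le]; simp
  have hcard : #{x : Grp p n | p • x = p • c} = p ^ 2 := by
    have := sum_fiber_eq (p := p) (f := fun _ => (1 : ℤ)) c
    rw [sum_const, sum_const, card_torsion_grp hn, nsmul_one, nsmul_one] at this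
    exact Nat.cast_injective this
  have hcount := card_fiber_generatorSet hn hbot (p • c)
  have hiff : ∀ x : Grp p n, x ≠ 0 →
      (signFun (generatorSet T) x = 1 ↔ AddSubgroup.zmultiples x ∈ T) := by
    intro x hx
    rw [signFun_generatorSet hx]
    split_ifs with h <;> simp [h]
  have hsg : ∀ x : Grp p n, x ≠ 0 →
      (signFun (generatorSet T) x = 1 ∨ signFun (generatorSet T) x = -1) := by
    intro x hx
    rw [signFun_generatorSet hx]
    split_ifs <;> simp
  rw [← sum_fiber_eq]
  have hsum : ∑ x with p • x = p • c, signFun (generatorSet T) x =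
      ∑ x with p • x = p • c ∧ x ≠ 0, signFun (generatorSet T) x := by
    rw [← Finset.filter_filter]
    refine (Finset.sum_filter_of_ne ?_).symm
    rintro x - hx rfl
    exact hx (by simp [signFun])
  have hpos : #{x ∈ ({x : Grp p n | p • x = p • c ∧ x ≠ 0} : Finset (Grp p n)) |
      signFun (generatorSet T) x = 1} = #{x | p • x = p • c ∧ AddSubgroup.zmultiples x ∈ T} := by
    congr 1
    ext x
    simp only [mem_filter, mem_univ, true_and]
    constructor
    · rintro ⟨⟨h1, h2⟩, h3⟩
      exact ⟨h1, (hiff x h2).1 h3⟩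
    · rintro ⟨h1, h2⟩
      have h3 : x ≠ 0 := by
        rintro rfl
        rw [AddSubgroup.zmultiples_zero_eq_bot] at h2
        exact hbot h2
      exact ⟨⟨h1, h3⟩, (hiff x h3).2 h2⟩
  rw [hsum, sum_sign _ (fun x hx => hsg x (by
    simp only [mem_filter, mem_univ, true_and] at hx
    exact hx.2)), hpos, hcount]
  by_cases hc : p • c = 0
  · have h1 : #{x : Grp p n | p • x = p • c ∧ x ≠ 0} = p ^ 2 - 1 := by
      have : ({x : Grp p n | p • x = p • c ∧ x ≠ 0} : Finset (Grp p n)) =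
          ({x : Grp p n | p • x = p • c} : Finset (Grp p n)).erase 0 := by
        ext; simp [and_comm]
      rw [this, Finset.card_erase_of_mem (by simp [hc]), hcard]
    have h2 : ((p ^ 2 - 1 : ℕ) : ℤ) = p ^ 2 - 1 := by
      rw [Nat.cast_sub (Nat.one_le_pow _ _ hp.pos)]; simp
    rw [h1, if_pos hc, if_pos hc, h2]
    push_cast [hp1]
    ring
  · have h1 : #{x : Grp p n | p • x = p • c ∧ x ≠ 0} = p ^ 2 := by
      rw [← hcard]
      congr 1
      ext x
      simp only [mem_filter, mem_univ, true_and, and_iff_left_iff_imp]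
      rintro h rfl
      exact hc (by rw [← h, smul_zero])
    rw [h1, if_neg hc, if_neg hc]
    push_cast
    ring

/-- Homogeneity for the Paley vector is the self-similarity of the sign function. -/
theorem isHomogeneous_iff (ho : Odd p) (hn : 0 < n) {T : Set (AddSubgroup (Grp p n))}
    (hT : T ⊆ Delta p n) (hbot : ⊥ ∉ T) :
    IsHomogeneous p n (paleyVector p n) T ↔
      ∀ c, ∑ z with p • z = 0, signFun (generatorSet T) (c + z) =
        p * signFun (generatorSet T) (p • c) := by
  classical
  have hp : p.Prime := Fact.out
  have hp0 : (p : ℤ) ≠ 0 := by exact_mod_cast hp.ne_zero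
  have hp1 : (p : ℤ) - 1 ≠ 0 := by have := hp.one_lt; omega
  have hlocal : ∀ (c : Grp p n) (i : Fin n),
      Nat.card (AddSubgroup.zmultiples (p • c)) = p ^ (i : ℕ) →
      ((sons (AddSubgroup.zmultiples (p • c)) ∩ T).ncard =
        (if AddSubgroup.zmultiples (p • c) ∈ T then paleyVector p n i + 1 else paleyVector p n i) ↔
      ∑ z with p • z = 0, signFun (generatorSet T) (c + z) =
        p * signFun (generatorSet T) (p • c)) := by
    intro c i hi
    rw [sum_fiber_signFun hn hbot]
    rw [Nat.card_zmultiples] at hi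
    obtain ⟨r, hr⟩ := ho
    by_cases hc : p • c = 0
    · have hi0 : (i : ℕ) = 0 := by
        rw [hc, addOrderOf_zero] at hi
        exact (Nat.pow_eq_one.1 hi.symm).resolve_left hp.one_lt.ne'
      rw [if_pos hc, hc, AddSubgroup.zmultiples_zero_eq_bot, if_neg hbot, paleyVector, if_pos hi0]
      simp only [signFun, if_true, mul_zero, mul_eq_zero, hp1, false_or]
      omega
    · have hi0 : (i : ℕ) ≠ 0 := by
        intro h
        rw [h, pow_zero, AddMonoid.addOrderOf_eq_one_iff] at hi
        exact hc hi
      rw [if_neg hc, signFun_generatorSet hc, mul_right_inj' hp0, paleyVector, if_neg hi0]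
      split_ifs <;> omega
  constructor
  · intro h c
    have hd : addOrderOf (p • c) ∣ p ^ (n - 1) := by
      apply addOrderOf_dvd_of_nsmul_eq_zero
      rw [← mul_smul, ← pow_succ, Nat.sub_add_cancel hn, pow_nsmul_grp]
    obtain ⟨i, hi, hci⟩ := (Nat.dvd_prime_pow hp).1 hd
    rw [← Nat.card_zmultiples] at hci
    rw [← hlocal c ⟨i, by omega⟩ hci]
    convert h.ncard_sons _ (mem_Delta_iff.2 ⟨_, rfl⟩) ⟨i, by omega⟩ hci
  · intro h
    refine ⟨?_, hT, hbot, ?_⟩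
    · intro i
      have := hp.two_le
      unfold paleyVector
      split_ifs <;> omega
    · intro H hH i hi
      obtain ⟨y, rfl⟩ := mem_Delta_iff.1 hH
      obtain ⟨k, hk, a, b, hab, rfl⟩ := exists_eq_pow_smul_primitive hn y
      have hk0 : k ≠ 0 := by
        rintro rfl
        rw [Nat.card_zmultiples, pow_zero, one_smul] at hi
        have h1 := addOrderOf_nsmul_eq_zero a
        rw [hi, pow_nsmul_eq_zero_iff hab] at h1
        omega
      obtain ⟨k, rfl⟩ := Nat.exists_eq_succ_of_ne_zero hk0
      rw [Nat.succ_eq_add_one, pow_succ', mul_smul] at hi ⊢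
      convert (hlocal _ i hi).2 (h _)

end Sons

/-! ### Both directions of the characterization -/

section Main

theorem IsPaleyFun.comp_equiv {A B : Type*} [AddCommGroup A] [Fintype A] [DecidableEq A]
    [AddCommGroup B] [Fintype B] [DecidableEq B] {f : A → ℤ} (hf : IsPaleyFun f) (e : A ≃+ B) :
    IsPaleyFun (fun b => f (e.symm b)) := by
  refine ⟨by simpa using hf.map_zero, fun x hx => hf.sign _ (by simpa using hx),
    fun x => by simpa using hf.map_neg (e.symm x), ?_, fun z => ?_⟩
  · rw [← hf.sum_eq_zero]
    exact Fintype.sum_equiv e.symm.toEquiv _ _ fun x => rfl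
  · have := hf.corr (e.symm z)
    simp only [EmbeddingLike.map_eq_zero_iff] at this
    rw [← Fintype.card_congr e.toEquiv, ← this]
    exact Fintype.sum_equiv e.symm.toEquiv _ _ fun x => by simp

theorem signFun_image {A B : Type*} [AddCommGroup A] [DecidableEq A]
    [AddCommGroup B] [DecidableEq B] (S : Set A) (e : A ≃+ B) :
    signFun (e '' S) = fun b => signFun S (e.symm b) := by
  ext b
  have : b ∈ e '' S ↔ e.symm b ∈ S := by
    constructor
    · rintro ⟨a, ha, rfl⟩
      simpa using ha
    · exact fun h => ⟨_, h, by simp⟩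
  simp only [signFun, EmbeddingLike.map_eq_zero_iff]
  by_cases h : e.symm b ∈ S
  · rw [if_pos h, if_pos (this.2 h)]
  · rw [if_neg h, if_neg (mt this.1 h)]

theorem exists_isHomogeneous {p n : ℕ} [Fact p.Prime] (ho : Odd p) (hn : 0 < n)
    {S : Set (Grp p n)} (h0 : 0 ∉ S) (hf : IsPaleyFun (signFun S)) :
    ∃ T, IsHomogeneous p n (paleyVector p n) T ∧ S = generatorSet T := by
  let T : Set (AddSubgroup (Grp p n)) := {H | ∃ g ∈ S, AddSubgroup.zmultiples g = H}
  have hinv := hf.unitInvariant ho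
  have hT : T ⊆ Delta p n := by
    rintro H ⟨g, -, rfl⟩
    exact mem_Delta_iff.2 ⟨g, rfl⟩
  have hbot : ⊥ ∉ T := by
    rintro ⟨g, hg, h⟩
    rw [AddSubgroup.zmultiples_eq_bot] at h
    exact h0 (h ▸ hg)
  have hS : S = generatorSet T := by
    ext x
    rw [mem_generatorSet]
    refine ⟨fun hx => ⟨x, hx, rfl⟩, ?_⟩
    rintro ⟨g, hg, h⟩
    obtain ⟨u, hu, rfl⟩ := exists_unit_smul_of_zmultiples_eq hn h
    have hg0 : g ≠ 0 := by rintro rfl; exact h0 hg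
    have h1 := hinv u hu g
    have hug : u • g ≠ 0 := fun h => hg0 (hu.smul_eq_zero.1 h)
    by_contra hn
    simp [signFun, hg, hg0, hug, hn] at h1
  refine ⟨T, ?_, hS⟩
  rw [isHomogeneous_iff ho hn hT hbot, ← hS]
  exact hf.sum_fiber ho hn

theorem isPaleySRCG_generatorSet {p n : ℕ} [Fact p.Prime] (ho : Odd p) (hn : 0 < n)
    {T : Set (AddSubgroup (Grp p n))} (hT : IsHomogeneous p n (paleyVector p n) T) :
    IsPaleySRCG (generatorSet T) := by
  have h0 : (0 : Grp p n) ∉ generatorSet T := by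
    rw [mem_generatorSet, AddSubgroup.zmultiples_zero_eq_bot]
    exact hT.bot_notMem
  have hinv : UnitInvariant (signFun (generatorSet T)) := by
    intro u hu x
    by_cases hx : x = 0
    · simp [hx]
    · classical
      have hux : u • x ≠ 0 := fun h => hx (hu.smul_eq_zero.1 h)
      rw [signFun_generatorSet hx, signFun_generatorSet hux, zmultiples_unit_smul hu]
  have hf : IsPaleyFun (signFun (generatorSet T)) := by
    refine hinv.isPaleyFun hn (by simp [signFun]) ?_
      ((isHomogeneous_iff ho hn hT.subset hT.bot_notMem).1 hT)
    intro x hx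
    classical
    rw [signFun_generatorSet hx]
    split_ifs <;> simp
  obtain ⟨r, hr⟩ : Odd (p ^ n) := ho.pow
  have hr1 : 1 ≤ r := by
    have := Nat.one_lt_pow hn.ne' (Fact.out : p.Prime).one_lt
    omega
  obtain ⟨s, rfl⟩ := Nat.exists_eq_add_of_le hr1
  refine hf.isPaleySRCG h0 (l := s ^ 2 + 3 * s + 1) ?_
  rw [card_grp, mul_comm, pow_mul, hr]
  ring

theorem rank_grp {p n : ℕ} [Fact p.Prime] (hn : 0 < n) : AddGroup.rank (Grp p n) = 2 := by
  classical
  refine le_antisymm ?_ ?_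
  · have hcl : AddSubgroup.closure ((({(1, 0), (0, 1)} : Finset (Grp p n))) : Set (Grp p n)) = ⊤ := by
      rw [AddSubgroup.eq_top_iff']
      rintro ⟨x, y⟩
      obtain ⟨i, rfl⟩ := ZMod.intCast_surjective x
      obtain ⟨j, rfl⟩ := ZMod.intCast_surjective y
      rw [Finset.coe_insert, Finset.coe_singleton, AddSubgroup.mem_closure_pair]
      exact ⟨i, j, by simp⟩
    exact (AddGroup.rank_le hcl).trans Finset.card_le_two
  · by_contra! hlt
    obtain ⟨S, hS, hcl⟩ := AddGroup.rank_spec (Grp p n)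
    obtain ⟨g, hg⟩ := Finset.card_le_one_iff_subset_singleton.1 (show #S ≤ 1 by omega)
    have hall : ∀ x, x ∈ AddSubgroup.zmultiples g := by
      intro x
      rw [AddSubgroup.zmultiples_eq_closure]
      refine AddSubgroup.closure_mono (h := (S : Set (Grp p n))) (by exact_mod_cast hg) ?_
      rw [hcl]
      trivial
    have h1 := addOrderOf_eq_card_of_forall_mem_zmultiples hall
    have h2 := Nat.le_of_dvd (pow_pos (Fact.out : p.Prime).pos n)
      (addOrderOf_dvd_of_nsmul_eq_zero (pow_nsmul_grp g))
    rw [h1, Nat.card_eq_fintype_card, card_grp,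
      Nat.pow_le_pow_iff_right (Fact.out : p.Prime).one_lt] at h2
    omega

theorem IsPaleyFun.exists_card_eq_pow {A : Type*} [AddCommGroup A] [Fintype A] [DecidableEq A]
    {f : A → ℤ} (hf : IsPaleyFun f) (hodd : Odd (Fintype.card A)) {g₁ g₂ : A}
    (hg : ∀ x, ∃ m n : ℤ, m • g₁ + n • g₂ = x) :
    ∃ p k : ℕ, p.Prime ∧ Odd p ∧ Fintype.card A = p ^ k := by
  by_cases h : ∃ p, p.Prime ∧ 5 ≤ p ∧ p ∣ Fintype.card A
  · obtain ⟨p, hp, hp5, hd⟩ := h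
    exact ⟨p, _, hp, hp.odd_of_ne_two (by omega), Nat.eq_prime_pow_of_unique_prime_dvd
      Fintype.card_ne_zero fun hq hqd => hf.eq_of_prime_dvd_card hp hp5 hd hg hq hqd⟩
  · push Not at h
    refine ⟨3, _, Nat.prime_three, by decide, Nat.eq_prime_pow_of_unique_prime_dvd
      Fintype.card_ne_zero fun {q} hq hqd => ?_⟩
    have h1 : q < 5 := by
      by_contra hcon
      exact h q hq (by omega) hqd
    have h2 : Odd q := hodd.of_dvd_nat hqd
    have h3 := hq.two_le
    interval_cases q
    · exact absurd h2 (by decide)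
    · rfl
    · exact absurd h2 (by decide)

end Main

end PaleyCayley

theorem corollary7p3 :
    (∀ (A : Type*) [AddCommGroup A] [Finite A], AddGroup.rank A = 2 →
      ∀ S : Set A, PaleyCayley.IsPaleySRCG S →
        ∃ p n : ℕ, p.Prime ∧ Odd p ∧ 0 < n ∧ Nonempty (A ≃+ PaleyCayley.Grp p n) ∧
          ∀ e : A ≃+ PaleyCayley.Grp p n,
            ∃ T : Set (AddSubgroup (PaleyCayley.Grp p n)),
              PaleyCayley.IsHomogeneous p n (PaleyCayley.paleyVector p n) T ∧
                e '' S = PaleyCayley.generatorSet T) ∧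
    (∀ (p n : ℕ) [Fact p.Prime], Odd p → 0 < n →
      AddGroup.rank (PaleyCayley.Grp p n) = 2 ∧
      ∀ T : Set (AddSubgroup (PaleyCayley.Grp p n)),
        PaleyCayley.IsHomogeneous p n (PaleyCayley.paleyVector p n) T →
          PaleyCayley.IsPaleySRCG (PaleyCayley.generatorSet T)) := by
  refine ⟨?_, ?_⟩
  · intro A _ _ hrank S hS
    classical
    have := Fintype.ofFinite A
    have hf := hS.isPaleyFun
    obtain ⟨g₁, g₂, hg⟩ := PaleyCayley.exists_generators_of_rank_eq_two hrank
    have hodd : Odd (Fintype.card A) := by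
      obtain ⟨k, -, -, hk, -⟩ := hS.isSRG
      rw [Nat.card_eq_fintype_card] at hk
      exact ⟨k, hk⟩
    obtain ⟨p, k, hp, ho, hk⟩ := hf.exists_card_eq_pow hodd hg
    obtain ⟨n, hn, he⟩ := hf.nonempty_addEquiv hp ho hk hg
      (PaleyCayley.not_isAddCyclic_of_rank_eq_two hrank)
    refine ⟨p, n, hp, ho, hn, he, fun e => ?_⟩
    have : Fact p.Prime := ⟨hp⟩
    refine PaleyCayley.exists_isHomogeneous ho hn ?_ ?_
    · rintro ⟨a, ha, h⟩
      rw [EmbeddingLike.map_eq_zero_iff] at h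
      exact hS.zero_notMem (h ▸ ha)
    · rw [PaleyCayley.signFun_image]
      exact hf.comp_equiv e
  · intro p n _ ho hn
    exact ⟨PaleyCayley.rank_grp hn, fun T hT => PaleyCayley.isPaleySRCG_generatorSet ho hn hT⟩
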